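/- Let $n\ge 2$, $p>1$, let $K\subset\mathbb{R}^n$ be a compact convex set with the origin in its interior, and let $u\in\mathbb{S}^{n-1}$. Notation. $h_L(v)=\sup_{x\in L}\langle x,v\rangle$ is the support function of $L$, and $L^*=\{x:\langle x,y\rangle\le 1\ \text{for all } y\in L\}$ is its polar. $S(L,\cdot)$ is the surface area measure of a convex body $L$, $S(L,\omega)=\mathcal{H}^{n-1}(\{x\in\partial L:\nu^L(x)\in\omega\})$, where $\nu^L(x)$ is the outer unit normal vector at $x$ (which is unique for $\mathcal H^{n-1}$-almost every $x\in\partial L$). For a convex body $L$ containing the origin in its interior, the $L_p$-projection body $\Pi_pL$ is the convex body with support function $$h_{\Pi_pL}(v)=\Big(\frac{1}{n\omega_nc_{n-2,p}}\int_{\mathbb{S}^{n-1}}|\langle v,\theta\rangle|^p\,h_L(\theta)^{1-p}\,dS(L,\theta)\Big)^{1/p},\qquad v\in\mathbb{S}^{n-1},$$ where $\omega_r=\pi^{r/2}/\Gamma(1+r/2)$ and $c_{r,p}=\omega_{r+p}/(\omega_2\omega_r\omega_{p-1})$, and $\Pi_p^*L=(\Pi_pL)^*$. Let $R_u$ be the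 reflection about $u^\perp$, and for $y\in u^\perp$ let $L(y)=\{s\in\mathbb{R}: y+su\in L\}$. The linear reflection shadow system $\{K_t\}_{t\in[-1,1]}$ of $K$ in the direction $u$ is given by $$K_t(y)=\tfrac{1+t}{2}\,K(y)+\tfrac{1-t}{2}\,(R_uK)(y),\qquad y\in u^\perp$$ (Minkowski combination of sections, empty where $K(y)$ is empty), and the Steiner symmetral $S_uK$ is obtained from $K$ by replacing each nonempty section $K(y)$, $y\in u^\perp$, by the closed segment of the same length centred at $0$. Theorem. (i) $\mathrm{vol}_n(\Pi_p^*K_t)=\mathrm{vol}_n(\Pi_p^*K_{-t})$ for all $t\in[-1,1]$. (ii) The function $t\mapsto\mathrm{vol}_n(\Pi_p^*K_t)$ is non-increasing on $[0,1]$. (iii) Consequently, $\mathrm{vol}_n(\Pi_p^*K)\le\mathrm{vol}_n(\Pi_p^*S_uK)$. -/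

import Mathlib

open MeasureTheory Set
open scoped Pointwise RealInnerProductSpace

noncomputable section

namespace LpProjection

/-- The Euclidean space `ℝⁿ`. -/
abbrev Euc (n : ℕ) : Type := EuclideanSpace ℝ (Fin n)

/-- `ω_r = π^{r/2} / Γ(1 + r/2)`. -/
def omega (r : ℝ) : ℝ := Real.pi ^ (r / 2) / Real.Gamma (1 + r / 2)

/-- `c_{r,p} = ω_{r+p} / (ω_2 ω_r ω_{p-1})`. -/
def cConst (r p : ℝ) : ℝ := omega (r + p) / (omega 2 * omega r * omega (p - 1))

variable {n : ℕ}

/-- The support function `h_K(v) = sup_{x ∈ K} ⟨x, v⟩`. -/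
def supportFun (K : Set (Euc n)) (v : Euc n) : ℝ := sSup ((fun x => ⟪x, v⟫) '' K)

/-- The polar set `K^* = {x : ⟨x, y⟩ ≤ 1 for all y ∈ K}`. -/
def polarSet (K : Set (Euc n)) : Set (Euc n) := {x | ∀ y ∈ K, ⟪x, y⟫ ≤ 1}

/-- `v` is an outer unit normal vector of `K` at the point `x`. -/
def IsOuterUnitNormal (K : Set (Euc n)) (x v : Euc n) : Prop :=
  ‖v‖ = 1 ∧ ∀ y ∈ K, ⟪y, v⟫ ≤ ⟪x, v⟫

/-- The boundary points of `K` at which the outer unit normal vector is unique. (For a convex body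
the other boundary points form a set of `(n-1)`-dimensional Hausdorff measure zero.) -/
def regularBoundary (K : Set (Euc n)) : Set (Euc n) :=
  {x | x ∈ frontier K ∧ ∃! v, IsOuterUnitNormal K x v}

open Classical in
/-- The Gauss map `ν^K`. It is only used on `regularBoundary K`, where the outer unit normal
vector exists and is unique. -/
def gaussMap (K : Set (Euc n)) (x : Euc n) : Euc n :=
  if h : ∃ v, IsOuterUnitNormal K x v then h.choose else 0

/-- The surface area measure `S(K, ω) = ℋ^{n-1}((ν^K)⁻¹(ω))`, as a measure on `ℝⁿ` that is
concentrated on the unit sphere. `μHE[n - 1]` is the Hausdorff measure `ℋ^{n-1}`, normalized so as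
to agree with Lebesgue measure on `ℝ^{n-1}`. -/
def surfaceAreaMeasure (K : Set (Euc n)) : Measure (Euc n) :=
  ((μHE[n - 1] : Measure (Euc n)).restrict (regularBoundary K)).map (gaussMap K)

/-- The right-hand side of the formula for the support function of the `L_p`-projection body. -/
def projectionSupport (p : ℝ) (K : Set (Euc n)) (v : Euc n) : ℝ :=
  (1 / (n * omega n * cConst ((n : ℝ) - 2) p) *
    ∫ θ, |⟪v, θ⟫| ^ p * supportFun K θ ^ (1 - p) ∂(surfaceAreaMeasure K)) ^ (1 / p)

/-- The `L_p`-projection body `Π_p K`: the closed convex set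
`{x : ⟨x, v⟩ ≤ h(v) for all unit vectors v}` with support function `h = projectionSupport p K`. -/
def projectionBody (p : ℝ) (K : Set (Euc n)) : Set (Euc n) :=
  {x | ∀ v : Euc n, ‖v‖ = 1 → ⟪x, v⟫ ≤ projectionSupport p K v}

/-- The polar `L_p`-projection body `Π_p^* K = (Π_p K)^*`. -/
def polarProjectionBody (p : ℝ) (K : Set (Euc n)) : Set (Euc n) :=
  polarSet (projectionBody p K)

/-- The one-dimensional section of `K` in the direction `u` over the point `y`, as a set of
parameters `s`. -/
def lineSection (K : Set (Euc n)) (u y : Euc n) : Set ℝ := {s | y + s • u ∈ K}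

/-- The reflection `R_u K` of `K` about the hyperplane `u^⊥`. -/
def reflectBody (u : Euc n) (K : Set (Euc n)) : Set (Euc n) :=
  Submodule.reflection ((Submodule.span ℝ {u})ᗮ) '' K

/-- The linear reflection shadow system: over each `y ∈ u^⊥` the section of `K_t` is the Minkowski
combination `(1+t)/2 · K(y) + (1-t)/2 · (R_u K)(y)`. -/
def reflectionShadow (K : Set (Euc n)) (u : Euc n) (t : ℝ) : Set (Euc n) :=
  {x | ∃ y ∈ (Submodule.span ℝ {u})ᗮ,
    ∃ s ∈ ((1 + t) / 2) • lineSection K u y + ((1 - t) / 2) • lineSection (reflectBody u K) u y,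
      x = y + s • u}

/-- The Steiner symmetral `S_u K`: each nonempty section of `K` in the direction `u` is replaced by
the closed segment of the same length centred on `u^⊥`. -/
def steinerSymm (u : Euc n) (K : Set (Euc n)) : Set (Euc n) :=
  {x | ∃ y ∈ (Submodule.span ℝ {u})ᗮ, (lineSection K u y).Nonempty ∧
    ∃ s : ℝ, |s| ≤ volume.real (lineSection K u y) / 2 ∧ x = y + s • u}

end LpProjection

end

noncomputable section

namespace LpProjection

variable {n : ℕ}

/-! Write `E_L(v) = ∫ |⟨v, ν⟩|^p ⟨x, ν⟩^{1-p} dℋ^{n-1}(x)` over the regular boundary of `L`. Since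
`h_L(ν(x)) = ⟨x, ν(x)⟩`, the support function of `Π_p L` is a constant times `E_L^{1/p}`, which is
sublinear by Minkowski's inequality. Hence `Π_p^* L` is a sublevel set of `E_L`, at a level
independent of `L` (`IsBody.polarProjectionBody_eq`).

Write points as `(y, s)` with `y ∈ u^⊥`, and split the boundary by the sign of `⟨ν, u⟩`. The upper
part is, up to a null set, the graph of a concave function `f` over the interior of the shadow `P`
of `L` on `u^⊥`, with normal `(-∇f, 1) / r`, where `r = √(1 + |∇f|²)`. The integrand is homogeneous
of degree `p + (1 - p) = 1` in the normal, so `r` cancels against the area element and the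
contribution at `v = (v', s)` is `∫_P |s - ⟨∇f, v'⟩|^p (f - ⟨∇f, y⟩)^{1-p} dy`. The lower part is
the upper part of `R_u L`. The lateral part depends only on `P`, the section lengths and `v'`, so it
is the same for `L`, `R_u L` and every `L_t` (`IsBody.lintegral_lateral_congr`).

With `l = (1+t)/2` and `m = (1-t)/2`, the upper function of `L_t` is `l f + m g`, where `g` is that
of `R_u L`. Joint convexity of `(a, b) ↦ |a|^p b^{1-p}` for `b > 0` gives `E_{L_t}(v', l a + m b) ≤
l E_L(v', a) + m E_{R_u L}(v', b)` (`IsBody.energy_reflectionShadow_le`). As `E_{R_u L}(v', -b) =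
E_L(v', b)`, heights `a, b` in the section of `Π_p^* L` over `v'` yield the height `l a - m b` in
that of `Π_p^* L_t`. Because `l + m = 1`, the new section is at least as long as the old one
(`volume_le_of_combination`), and Fubini gives `vol(Π_p^* L) ≤ vol(Π_p^* L_t)`.

The rest is algebra of the system: `R_u K_t = K_{-t}` gives (i), `(K_{t'})_τ = K_{t' τ}` with `τ = t
/ t'` gives (ii), and `K_0 = S_u K` gives (iii). -/

/-- A convex body containing the origin in its interior. -/
structure IsBody (L : Set (Euc n)) : Prop where
  convex : Convex ℝ L
  compact : IsCompact L
  zero_mem : (0 : Euc n) ∈ interior L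

namespace IsBody

variable {L : Set (Euc n)}

lemma exists_closedBall_subset (hL : IsBody L) : ∃ r > 0, Metric.closedBall (0 : Euc n) r ⊆ L :=
  Metric.nhds_basis_closedBall.mem_iff.1 (mem_interior_iff_mem_nhds.1 hL.zero_mem)

lemma frontier_subset (hL : IsBody L) : frontier L ⊆ L := hL.compact.isClosed.frontier_subset

/-- Test the normal against `r • v`, which lies in the ball. This uniform lower bound keeps the
negative power `⟨x, ν⟩^{1-p}` bounded. -/
lemma le_inner_of_normal {r : ℝ} (hr : 0 ≤ r) (h : Metric.closedBall (0 : Euc n) r ⊆ L)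
    {x v : Euc n} (hv : IsOuterUnitNormal L x v) : r ≤ ⟪x, v⟫ := by
  have h1 : r • v ∈ L := h (by simp [norm_smul, hv.1, abs_of_nonneg hr])
  simpa [real_inner_smul_left, real_inner_self_eq_norm_sq, hv.1] using hv.2 _ h1

lemma inner_pos_of_normal (hL : IsBody L) {x v : Euc n} (hv : IsOuterUnitNormal L x v) :
    0 < ⟪x, v⟫ := by
  obtain ⟨r, hr, h⟩ := hL.exists_closedBall_subset
  exact hr.trans_le (le_inner_of_normal hr.le h hv)

lemma not_mem_interior_of_normal {x v : Euc n} (hv : IsOuterUnitNormal L x v) :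
    x ∉ interior L := by
  intro hx
  obtain ⟨r, hr, h⟩ := Metric.nhds_basis_closedBall.mem_iff.1 (mem_interior_iff_mem_nhds.1 hx)
  have h1 : x + r • v ∈ L := h (by simp [norm_smul, hv.1, abs_of_nonneg hr.le])
  have := hv.2 _ h1
  simp [inner_add_left, real_inner_smul_left, hv.1] at this
  linarith

lemma mem_frontier_of_normal {x v : Euc n} (hx : x ∈ L) (hv : IsOuterUnitNormal L x v) :
    x ∈ frontier L := ⟨subset_closure hx, not_mem_interior_of_normal hv⟩

end IsBody

lemma supportFun_eq_of_normal {L : Set (Euc n)} {x v : Euc n} (hx : x ∈ L)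
    (hv : IsOuterUnitNormal L x v) : supportFun L v = ⟪x, v⟫ :=
  IsGreatest.csSup_eq ⟨mem_image_of_mem _ hx, by rintro _ ⟨y, hy, rfl⟩; exact hv.2 y hy⟩

lemma IsBody.bddAbove_inner {L : Set (Euc n)} (hL : IsBody L) (v : Euc n) :
    BddAbove ((fun x => ⟪x, v⟫) '' L) :=
  (hL.compact.image (by fun_prop)).bddAbove

lemma IsBody.continuous_supportFun {L : Set (Euc n)} (hL : IsBody L) :
    Continuous (supportFun L) := by
  obtain ⟨R, hR⟩ := hL.compact.isBounded.exists_norm_le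
  have hne : L.Nonempty := ⟨0, interior_subset hL.zero_mem⟩
  refine (LipschitzWith.of_le_add_mul R.toNNReal fun v w => ?_).continuous
  refine csSup_le (hne.image _) ?_
  rintro _ ⟨x, hx, rfl⟩
  have h1 : ⟪x, w⟫ ≤ supportFun L w := le_csSup (hL.bddAbove_inner w) ⟨x, hx, rfl⟩
  have h2 : ⟪x, v - w⟫ ≤ ‖x‖ * ‖v - w‖ := real_inner_le_norm _ _
  have h3 : ‖x‖ * ‖v - w‖ ≤ R.toNNReal * ‖v - w‖ := by
    gcongr; exact (hR x hx).trans (Real.le_coe_toNNReal R)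
  rw [inner_sub_right] at h2
  rw [dist_eq_norm]
  simp only
  linarith

/-! ### The regular boundary and the Gauss map -/

lemma gaussMap_spec {L : Set (Euc n)} {x : Euc n} (hx : x ∈ regularBoundary L) :
    IsOuterUnitNormal L x (gaussMap L x) := by
  unfold gaussMap
  rw [dif_pos hx.2.exists]
  exact hx.2.exists.choose_spec

lemma gaussMap_eq {L : Set (Euc n)} {x v : Euc n} (hx : x ∈ regularBoundary L)
    (hv : IsOuterUnitNormal L x v) : gaussMap L x = v :=
  hx.2.unique (gaussMap_spec hx) hv

lemma IsBody.mem_of_regular {L : Set (Euc n)} (hL : IsBody L) {x : Euc n}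
    (hx : x ∈ regularBoundary L) : x ∈ L := hL.frontier_subset hx.1

lemma isClosed_normal (L : Set (Euc n)) :
    IsClosed {q : Euc n × Euc n | IsOuterUnitNormal L q.1 q.2} := by
  simp only [IsOuterUnitNormal, Set.ofPred_and, Set.ofPred_forall]
  refine IsClosed.inter (isClosed_eq (by fun_prop) (by fun_prop)) ?_
  exact isClosed_iInter fun y => isClosed_iInter fun _ => isClosed_le (by fun_prop) (by fun_prop)

/-- Boundary points having an outer unit normal in a prescribed closed set form a closed set. -/
lemma IsBody.isClosed_normal_mem {L C : Set (Euc n)} (hL : IsBody L) (hC : IsClosed C) :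
    IsClosed {x | x ∈ frontier L ∧ ∃ v ∈ C, IsOuterUnitNormal L x v} := by
  have hf : IsCompact (frontier L) :=
    hL.compact.of_isClosed_subset isClosed_frontier hL.frontier_subset
  have : {x | x ∈ frontier L ∧ ∃ v ∈ C, IsOuterUnitNormal L x v} = Prod.fst ''
      ((frontier L ×ˢ Metric.sphere (0 : Euc n) 1) ∩
        ({q | IsOuterUnitNormal L q.1 q.2} ∩ {q | q.2 ∈ C})) := by
    ext x
    simp only [Set.mem_ofPred_eq, mem_image, mem_inter_iff, mem_prod, Prod.exists, exists_and_right,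
      exists_eq_right, mem_sphere_zero_iff_norm]
    exact ⟨fun ⟨h, v, hv, hn⟩ => ⟨v, ⟨h, hn.1⟩, hn, hv⟩, fun ⟨v, ⟨h, _⟩, hn, hv⟩ => ⟨h, v, hv, hn⟩⟩
  rw [this]
  refine (IsCompact.image ?_ continuous_fst).isClosed
  exact (hf.prod (isCompact_sphere _ _)).inter_right
    ((isClosed_normal L).inter (hC.preimage continuous_snd))

/-- A projection of a compact set of triples (point, normal, normal). With `ε = 1/(k+1)` these sets
exhaust the boundary points whose normal is not unique, which makes `regularBoundary L` Borel. -/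
lemma IsBody.isClosed_normal_far {L : Set (Euc n)} (hL : IsBody L) (ε : ℝ) :
    IsClosed {x | x ∈ frontier L ∧ ∃ v w, IsOuterUnitNormal L x v ∧ IsOuterUnitNormal L x w ∧
      ε ≤ ‖v - w‖} := by
  have hf : IsCompact (frontier L) :=
    hL.compact.of_isClosed_subset isClosed_frontier hL.frontier_subset
  have : {x | x ∈ frontier L ∧ ∃ v w, IsOuterUnitNormal L x v ∧ IsOuterUnitNormal L x w ∧
      ε ≤ ‖v - w‖} = Prod.fst ''
      ((frontier L ×ˢ (Metric.sphere (0 : Euc n) 1 ×ˢ Metric.sphere (0 : Euc n) 1)) ∩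
        (((fun q : Euc n × Euc n × Euc n => (q.1, q.2.1)) ⁻¹' {q | IsOuterUnitNormal L q.1 q.2} ∩
        (fun q : Euc n × Euc n × Euc n => (q.1, q.2.2)) ⁻¹' {q | IsOuterUnitNormal L q.1 q.2}) ∩
          {q | ε ≤ ‖q.2.1 - q.2.2‖})) := by
    ext x
    simp only [Set.mem_ofPred_eq, mem_image, mem_inter_iff, mem_prod, Prod.exists, exists_and_right,
      exists_eq_right, mem_sphere_zero_iff_norm, mem_preimage]
    exact ⟨fun ⟨h, v, w, hv, hw, hn⟩ => ⟨v, w, ⟨h, hv.1, hw.1⟩, ⟨hv, hw⟩, hn⟩,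
      fun ⟨v, w, ⟨h, _⟩, ⟨hv, hw⟩, hn⟩ => ⟨h, v, w, hv, hw, hn⟩⟩
  rw [this]
  refine (IsCompact.image ?_ continuous_fst).isClosed
  refine (hf.prod ((isCompact_sphere _ _).prod (isCompact_sphere _ _))).inter_right ?_
  exact (((isClosed_normal L).preimage (by fun_prop)).inter
    ((isClosed_normal L).preimage (by fun_prop))).inter (isClosed_le (by fun_prop) (by fun_prop))

lemma IsBody.measurableSet_regularBoundary {L : Set (Euc n)} (hL : IsBody L) :
    MeasurableSet (regularBoundary L) := by
  have : regularBoundary L =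
      {x | x ∈ frontier L ∧ ∃ v ∈ (univ : Set (Euc n)), IsOuterUnitNormal L x v} \
        ⋃ k : ℕ, {x | x ∈ frontier L ∧ ∃ v w, IsOuterUnitNormal L x v ∧ IsOuterUnitNormal L x w ∧
          1 / ((k : ℝ) + 1) ≤ ‖v - w‖} := by
    ext x
    simp only [regularBoundary, Set.mem_ofPred_eq, mem_univ, true_and, Set.mem_sdiff, mem_iUnion, not_exists,
      not_and]
    constructor
    · rintro ⟨hx, hu⟩
      refine ⟨⟨hx, hu.exists⟩, fun k _ v w hv hw h => ?_⟩
      rw [hu.unique hv hw, sub_self, norm_zero] at h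
      exact absurd h (not_le.2 Nat.one_div_pos_of_nat)
    · rintro ⟨⟨hx, v, hv⟩, h⟩
      refine ⟨hx, v, hv, fun w hw => ?_⟩
      by_contra hne
      obtain ⟨k, hk⟩ := exists_nat_one_div_lt (norm_pos_iff.2 (sub_ne_zero.2 hne))
      exact h k hx w v hw hv hk.le
  rw [this]
  exact (hL.isClosed_normal_mem isClosed_univ).measurableSet.diff
    (MeasurableSet.iUnion fun k => (hL.isClosed_normal_far _).measurableSet)

/-- By uniqueness of the normal, the preimage of a closed `C` is the trace of the closed set of
boundary points having some normal in `C`. -/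
lemma IsBody.measurable_gaussMap {L : Set (Euc n)} (hL : IsBody L) :
    Measurable (fun x : regularBoundary L => gaussMap L x) := by
  refine measurable_of_isClosed fun C hC => ?_
  have : (fun x : regularBoundary L => gaussMap L x) ⁻¹' C =
      Subtype.val ⁻¹' {x | x ∈ frontier L ∧ ∃ v ∈ C, IsOuterUnitNormal L x v} := by
    ext ⟨x, hx⟩
    simp only [mem_preimage, Set.mem_ofPred_eq]
    exact ⟨fun h => ⟨hx.1, _, h, gaussMap_spec hx⟩, fun ⟨_, v, hv, hn⟩ => gaussMap_eq hx hn ▸ hv⟩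
  rw [this]
  exact measurable_subtype_coe (hL.isClosed_normal_mem hC).measurableSet

lemma IsBody.aemeasurable_gaussMap {L : Set (Euc n)} (hL : IsBody L) (μ : Measure (Euc n)) :
    AEMeasurable (gaussMap L) (μ.restrict (regularBoundary L)) :=
  aemeasurable_restrict_of_measurable_subtype hL.measurableSet_regularBoundary
    hL.measurable_gaussMap

/-! ### Orthogonal coordinates `u^⊥ × ℝ` on `ℝⁿ` -/

/-- The hyperplane `u^⊥`. -/
abbrev Hyp (u : Euc n) : Submodule ℝ (Euc n) := (Submodule.span ℝ {u})ᗮ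

/-- The point of `ℝⁿ` over `y ∈ u^⊥` at height `s`. -/
def pt (u : Euc n) (y : Hyp u) (s : ℝ) : Euc n := (y : Euc n) + s • u

/-- The orthogonal projection onto `u^⊥`. -/
def hproj (u : Euc n) : Euc n →L[ℝ] Hyp u := (Hyp u).orthogonalProjectionOnto

section geometry

variable {u : Euc n}

lemma inner_hyp_left (y : Hyp u) : ⟪(y : Euc n), u⟫ = 0 := by
  have := Submodule.mem_orthogonal_singleton_iff_inner_left.1 y.2
  simpa using this

lemma inner_hyp_right (y : Hyp u) : ⟪u, (y : Euc n)⟫ = 0 := by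
  rw [real_inner_comm]; exact inner_hyp_left y

lemma inner_pt_u (hu : ‖u‖ = 1) (y : Hyp u) (s : ℝ) : ⟪pt u y s, u⟫ = s := by
  simp [pt, inner_add_left, inner_hyp_left, real_inner_smul_left, hu]

lemma inner_pt_pt (hu : ‖u‖ = 1) (y z : Hyp u) (s t : ℝ) :
    ⟪pt u y s, pt u z t⟫ = ⟪y, z⟫ + s * t := by
  simp [pt, inner_add_left, inner_add_right, inner_hyp_left, inner_hyp_right,
    real_inner_smul_left, real_inner_smul_right, hu, mul_comm]

lemma norm_pt_sq (hu : ‖u‖ = 1) (y : Hyp u) (s : ℝ) : ‖pt u y s‖ ^ 2 = ‖y‖ ^ 2 + s ^ 2 := by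
  rw [← real_inner_self_eq_norm_sq, inner_pt_pt hu, real_inner_self_eq_norm_sq]; ring

lemma hproj_u : hproj u u = 0 := by
  rw [hproj, Submodule.orthogonalProjectionOnto_eq_zero_iff, Submodule.orthogonal_orthogonal]
  exact Submodule.mem_span_singleton_self u

lemma hproj_pt (y : Hyp u) (s : ℝ) : hproj u (pt u y s) = y := by
  rw [pt, map_add, map_smul, hproj_u, smul_zero, add_zero]
  exact Submodule.orthogonalProjectionOnto_mem_subspace_eq_self y

lemma pt_hproj (hu : ‖u‖ = 1) (x : Euc n) : pt u (hproj u x) ⟪x, u⟫ = x := by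
  have h := (Submodule.span ℝ {u}).starProjection_add_starProjection_orthogonal x
  rw [Submodule.starProjection_unit_singleton ℝ hu, real_inner_comm] at h
  rw [pt, add_comm]
  exact h

lemma pt_injective (hu : ‖u‖ = 1) {y z : Hyp u} {s t : ℝ} (h : pt u y s = pt u z t) :
    y = z ∧ s = t :=
  ⟨by rw [← hproj_pt y s, h, hproj_pt], by rw [← inner_pt_u hu y s, h, inner_pt_u hu]⟩

lemma pt_add (y z : Hyp u) (s t : ℝ) : pt u y s + pt u z t = pt u (y + z) (s + t) := by
  simp only [pt, Submodule.coe_add]; module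

lemma pt_smul (c : ℝ) (y : Hyp u) (s : ℝ) : c • pt u y s = pt u (c • y) (c * s) := by
  simp only [pt, Submodule.coe_smul]; module

lemma continuous_pt : Continuous (fun q : Hyp u × ℝ => pt u q.1 q.2) := by
  unfold pt; fun_prop

lemma norm_hproj_le (x : Euc n) : ‖hproj u x‖ ≤ ‖x‖ :=
  Submodule.norm_orthogonalProjectionOnto_apply_le _ _

lemma inner_hproj (hu : ‖u‖ = 1) (y : Hyp u) (x : Euc n) : ⟪y, hproj u x⟫ = ⟪(y : Euc n), x⟫ := by
  conv_rhs => rw [← pt_hproj hu x]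
  simp [pt, inner_add_right, real_inner_smul_right, inner_hyp_left]

lemma finrank_hyp (hu : ‖u‖ = 1) : Module.finrank ℝ (Hyp u) = n - 1 := by
  have hu0 : u ≠ 0 := by rintro rfl; simp at hu
  have h1 := Submodule.finrank_add_finrank_orthogonal (Submodule.span ℝ {u})
  rw [finrank_span_singleton hu0, finrank_euclideanSpace_fin] at h1
  change Module.finrank ℝ (Submodule.span ℝ {u})ᗮ = n - 1
  omega

lemma volume_hyp (hu : ‖u‖ = 1) : (μHE[n - 1] : Measure (Hyp u)) = volume := by
  rw [← finrank_hyp hu]; exact InnerProductSpace.euclideanHausdorffMeasure_eq_volume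

/-- `u^⊥ × ℝ ≃ ℝⁿ` as measurable spaces. -/
def ptEquiv (hu : ‖u‖ = 1) : Hyp u × ℝ ≃ₜ Euc n where
  toFun q := pt u q.1 q.2
  invFun x := (hproj u x, ⟪x, u⟫)
  left_inv q := by simp [hproj_pt, inner_pt_u hu]
  right_inv x := pt_hproj hu x
  continuous_toFun := continuous_pt
  continuous_invFun := by fun_prop

/-- `u^⊥ ⊕ ℝ ≃ ℝⁿ` as inner product spaces. -/
def ptIsometry (hu : ‖u‖ = 1) : WithLp 2 (Hyp u × ℝ) ≃ₗᵢ[ℝ] Euc n where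
  toFun q := pt u q.fst q.snd
  invFun x := WithLp.toLp 2 (hproj u x, ⟪x, u⟫)
  left_inv q := by simp [hproj_pt, inner_pt_u hu]; rfl
  right_inv x := pt_hproj hu x
  map_add' q r := by simp [pt_add]
  map_smul' c q := by simp [pt_smul]
  norm_map' q := by
    rw [← sq_eq_sq₀ (norm_nonneg _) (norm_nonneg _), WithLp.prod_norm_sq_eq_of_L2]
    simp only [Real.norm_eq_abs, sq_abs]
    exact norm_pt_sq hu q.fst q.snd

lemma measurePreserving_pt (hu : ‖u‖ = 1) :
    MeasurePreserving (fun q : Hyp u × ℝ => pt u q.1 q.2) (volume.prod volume) volume :=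
  (ptIsometry hu).measurePreserving.comp (WithLp.volume_preserving_toLp (Hyp u) ℝ)

end geometry

/-! ### Euclidean Hausdorff measure under Lipschitz maps -/

section hausdorff

variable {X Y : Type*} [EMetricSpace X] [MeasurableSpace X] [BorelSpace X]
  [EMetricSpace Y] [MeasurableSpace Y] [BorelSpace Y]

lemma _root_.LipschitzOnWith.euclideanHausdorffMeasure_image_le {K : NNReal} {f : X → Y} {s : Set X}
    (h : LipschitzOnWith K f s) (d : ℕ) :
    (μHE[d] : Measure Y) (f '' s) ≤ (K : ENNReal) ^ d * (μHE[d] : Measure X) s := by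
  simp only [Measure.euclideanHausdorffMeasure_def, Measure.smul_apply, ENNReal.smul_def,
    smul_eq_mul]
  rw [mul_left_comm]
  gcongr
  simpa using h.hausdorffMeasure_image_le (d := d) (by positivity)

end hausdorff

/-! ### Finiteness of the surface area -/

/-- On the shell the gauge is Lipschitz and bounded below by `1/ρ`, where `ρ` bounds the norms in
`L`. This radial map carries flat pieces onto the boundary of `L`. -/
lemma IsBody.lipschitzOnWith_radial {L : Set (Euc n)} (hL : IsBody L) (R : ℝ) :
    ∃ C, LipschitzOnWith C (fun z : Euc n => (gauge L z)⁻¹ • z) {z | 1 ≤ ‖z‖ ∧ ‖z‖ ≤ R} := by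
  obtain ⟨K, hK⟩ := hL.convex.lipschitz_gauge (mem_interior_iff_mem_nhds.1 hL.zero_mem)
  obtain ⟨ρ, hρ⟩ := hL.compact.isBounded.exists_pos_norm_le
  obtain ⟨hρ0, hρ⟩ := hρ
  have hsub : L ⊆ Metric.closedBall 0 ρ := fun x hx => by simpa using hρ x hx
  have habs : Absorbent ℝ L := absorbent_nhds_zero (mem_interior_iff_mem_nhds.1 hL.zero_mem)
  have hg : ∀ z : Euc n, 1 ≤ ‖z‖ → 1 / ρ ≤ gauge L z := fun z hz =>
    (div_le_div_of_nonneg_right hz hρ0.le).trans (le_gauge_of_subset_closedBall habs hρ0.le hsub)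
  refine ⟨(ρ + R * (ρ * (ρ * K))).toNNReal, LipschitzOnWith.of_dist_le_mul ?_⟩
  rintro z ⟨hz1, hz2⟩ w ⟨hw1, hw2⟩
  have hgz := hg z hz1
  have hgw := hg w hw1
  have h0 : 0 < 1 / ρ := by positivity
  have hz0 := h0.trans_le hgz
  have hw0 := h0.trans_le hgw
  have hd : |gauge L w - gauge L z| ≤ K * ‖z - w‖ := by
    have := hK.dist_le_mul w z
    rwa [Real.dist_eq, dist_eq_norm, norm_sub_rev] at this
  have hid : (gauge L z)⁻¹ • z - (gauge L w)⁻¹ • w =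
      (gauge L z)⁻¹ • (z - w) + ((gauge L z)⁻¹ * ((gauge L w)⁻¹ * (gauge L w - gauge L z))) • w := by
    have : (gauge L z)⁻¹ * ((gauge L w)⁻¹ * (gauge L w - gauge L z)) =
        (gauge L z)⁻¹ - (gauge L w)⁻¹ := by field_simp
    rw [this]; module
  have hiz : (gauge L z)⁻¹ ≤ ρ := by
    rw [inv_le_comm₀ hz0 hρ0]; simpa using hgz
  have hiw : (gauge L w)⁻¹ ≤ ρ := by
    rw [inv_le_comm₀ hw0 hρ0]; simpa using hgw
  have hR0 : 0 ≤ R := (norm_nonneg _).trans hz2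
  rw [dist_eq_norm, dist_eq_norm, hid]
  refine (norm_add_le _ _).trans ?_
  rw [norm_smul, norm_smul, norm_mul, norm_mul, norm_inv, norm_inv, Real.norm_of_nonneg hz0.le,
    Real.norm_of_nonneg hw0.le, Real.norm_eq_abs]
  have h1 : (gauge L z)⁻¹ * ‖z - w‖ ≤ ρ * ‖z - w‖ := by gcongr
  have h2 : (gauge L z)⁻¹ * ((gauge L w)⁻¹ * |gauge L w - gauge L z|) * ‖w‖ ≤
      ρ * (ρ * (K * ‖z - w‖)) * R := by gcongr
  calc _ ≤ ρ * ‖z - w‖ + ρ * (ρ * (K * ‖z - w‖)) * R := add_le_add h1 h2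
    _ = (ρ + R * (ρ * (ρ * K))) * ‖z - w‖ := by ring
    _ ≤ _ := by gcongr; exact Real.le_coe_toNNReal _

lemma exists_coord_large (hn : 0 < n) {x : Euc n} (hx : x ≠ 0) :
    ∃ i, 0 < |x i| ∧ ‖x‖ ≤ n * |x i| := by
  have : Nonempty (Fin n) := ⟨⟨0, hn⟩⟩
  obtain ⟨i, hi⟩ := Finite.exists_max (fun i => |x i|)
  have h : ‖x‖ ≤ n * |x i| := by
    have h1 : ‖x‖ ^ 2 ≤ (n * |x i|) ^ 2 := by
      rw [EuclideanSpace.norm_sq_eq]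
      calc ∑ j, ‖x j‖ ^ 2 ≤ ∑ _j : Fin n, |x i| ^ 2 := by
            gcongr with j; exact hi j
        _ = n * |x i| ^ 2 := by simp
        _ ≤ (n * |x i|) ^ 2 := by
            rw [mul_pow]
            gcongr
            have : (1 : ℝ) ≤ n := by exact_mod_cast hn
            nlinarith
    exact le_of_sq_le_sq h1 (by positivity)
  refine ⟨i, ?_, h⟩
  by_contra h0
  have h2 : |x i| = 0 := le_antisymm (not_lt.1 h0) (abs_nonneg _)
  rw [h2, mul_zero] at h
  exact hx (norm_le_zero_iff.1 h)

/-- Rescaling a boundary point so that its largest coordinate becomes `±1` puts it in a bounded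
piece of one of the `2n` hyperplanes `⟨z, ±e_i⟩ = 1`. The boundary is thus covered by Lipschitz
images of finitely many pieces of finite area. -/
lemma IsBody.hausdorff_frontier_lt_top {L : Set (Euc n)} (hL : IsBody L) (hn : 0 < n) :
    (μHE[n - 1] : Measure (Euc n)) (frontier L) < ⊤ := by
  obtain ⟨C, hC⟩ := hL.lipschitzOnWith_radial n
  let w : Fin n × Bool → Euc n := fun q =>
    (if q.2 then (1 : ℝ) else -1) • EuclideanSpace.single q.1 (1 : ℝ)
  have hw : ∀ q, ‖w q‖ = 1 := by rintro ⟨i, b⟩; cases b <;> simp [w]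
  let D : Fin n × Bool → Set (Euc n) := fun q =>
    (fun y : Hyp (w q) => pt (w q) y 1) '' Metric.closedBall 0 n ∩ {z | 1 ≤ ‖z‖ ∧ ‖z‖ ≤ n}
  have hD : ∀ q, (μHE[n - 1] : Measure (Euc n)) (D q) < ⊤ := by
    intro q
    have hiso : Isometry (fun y : Hyp (w q) => pt (w q) y 1) :=
      Isometry.of_dist_eq fun y z => by
        simp only [pt, dist_add_right]; rfl
    refine (measure_mono inter_subset_left).trans_lt ?_
    rw [hiso.euclideanHausdorffMeasure_image, volume_hyp (hw q)]
    exact (isCompact_closedBall _ _).measure_lt_top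
  have hcover : frontier L ⊆ ⋃ q, (fun z : Euc n => (gauge L z)⁻¹ • z) '' D q := by
    intro x hx
    have hx0 : x ≠ 0 := by rintro rfl; exact hx.2 hL.zero_mem
    obtain ⟨i, hi, hi'⟩ := exists_coord_large hn hx0
    have hg : gauge L x = 1 :=
      (gauge_eq_one_iff_mem_frontier hL.convex (mem_interior_iff_mem_nhds.1 hL.zero_mem)).2 hx
    let q : Fin n × Bool := (i, decide (0 < x i))
    have hs : ⟪x, EuclideanSpace.single i (1 : ℝ)⟫ = x i := by
      rw [EuclideanSpace.inner_single_right]; simp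
    have hin : ⟪x, w q⟫ = |x i| := by
      by_cases h : 0 < x i
      · simp [w, q, h, abs_of_pos h, hs]
      · simp [w, q, h, abs_of_nonpos (not_lt.1 h), hs]
    have hzin : ⟪|x i|⁻¹ • x, w q⟫ = 1 := by
      rw [real_inner_smul_left, hin, inv_mul_cancel₀ hi.ne']
    have hnz : ‖|x i|⁻¹ • x‖ ≤ n := by
      rw [norm_smul, norm_inv, norm_abs_eq_norm, Real.norm_eq_abs, inv_mul_le_iff₀ hi, mul_comm]
      exact hi'
    refine mem_iUnion.2 ⟨q, |x i|⁻¹ • x, ⟨⟨hproj (w q) (|x i|⁻¹ • x), ?_, ?_⟩, ?_, hnz⟩, ?_⟩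
    · simpa using (norm_hproj_le (u := w q) (|x i|⁻¹ • x)).trans hnz
    · simp only
      rw [← hzin]; exact pt_hproj (hw q) _
    · rw [← hzin]
      exact (real_inner_le_norm _ _).trans (by rw [hw q, mul_one])
    · simp only
      rw [gauge_smul_of_nonneg (by positivity), hg, smul_smul]
      simp [hi.ne']
  refine (measure_mono hcover).trans_lt ((measure_iUnion_fintype_le _ _).trans_lt ?_)
  refine ENNReal.sum_lt_top.2 fun q _ => ?_
  refine ((hC.mono inter_subset_right).euclideanHausdorffMeasure_image_le (n - 1)).trans_lt ?_
  exact ENNReal.mul_lt_top (by finiteness) (hD q)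

/-! ### The energy -/

/-- The integral `∫ |⟨v, ν⟩|^p ⟨x, ν⟩^{1-p} dℋ^{n-1}(x)` over the regular boundary. -/
def energy (p : ℝ) (L : Set (Euc n)) (v : Euc n) : ENNReal :=
  ∫⁻ x in regularBoundary L,
    ENNReal.ofReal (|⟪v, gaussMap L x⟫| ^ p * ⟪x, gaussMap L x⟫ ^ (1 - p)) ∂μHE[n - 1]

lemma IsBody.aemeasurable_density {L : Set (Euc n)} (hL : IsBody L) (p q : ℝ) (v : Euc n) :
    AEMeasurable (fun x => |⟪v, gaussMap L x⟫| ^ p * ⟪x, gaussMap L x⟫ ^ q)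
      ((μHE[n - 1] : Measure (Euc n)).restrict (regularBoundary L)) := by
  have h := hL.aemeasurable_gaussMap μHE[n - 1]
  have h1 : AEMeasurable (fun x => ⟪v, gaussMap L x⟫)
      ((μHE[n - 1] : Measure (Euc n)).restrict (regularBoundary L)) :=
    (aemeasurable_const (b := v)).inner h
  have h2 : AEMeasurable (fun x => ⟪x, gaussMap L x⟫)
      ((μHE[n - 1] : Measure (Euc n)).restrict (regularBoundary L)) :=
    aemeasurable_id.inner h
  have h3 : AEMeasurable (fun x => |⟪v, gaussMap L x⟫|)
      ((μHE[n - 1] : Measure (Euc n)).restrict (regularBoundary L)) := h1.norm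
  exact (h3.pow_const p).mul (h2.pow_const q)

lemma IsBody.energy_lt_top {L : Set (Euc n)} (hL : IsBody L) (hn : 0 < n) {p : ℝ} (hp : 1 < p)
    (v : Euc n) : energy p L v < ⊤ := by
  obtain ⟨r, hr, h⟩ := hL.exists_closedBall_subset
  have hfin : (μHE[n - 1] : Measure (Euc n)) (regularBoundary L) < ⊤ :=
    (measure_mono fun x hx => hx.1).trans_lt (hL.hausdorff_frontier_lt_top hn)
  refine setLIntegral_lt_top_of_le_nnreal hfin.ne ⟨(‖v‖ ^ p * r ^ (1 - p)).toNNReal, ?_⟩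
  intro x hx
  have hν := gaussMap_spec hx
  have h1 : |⟪v, gaussMap L x⟫| ≤ ‖v‖ := by
    simpa [hν.1] using abs_real_inner_le_norm v (gaussMap L x)
  have h2 := IsBody.le_inner_of_normal hr.le h hν
  refine ENNReal.ofReal_le_ofReal ?_
  exact mul_le_mul (Real.rpow_le_rpow (abs_nonneg _) h1 (by linarith))
    (Real.rpow_le_rpow_of_nonpos hr h2 (by linarith))
    (Real.rpow_nonneg (hr.le.trans h2) _) (by positivity)

/-- The normalizing constant in the definition of the `L_p`-projection body. -/
def projConst (n : ℕ) (p : ℝ) : ℝ := 1 / (n * omega n * cConst ((n : ℝ) - 2) p)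

lemma omega_pos {r : ℝ} (hr : -2 < r) : 0 < omega r := by
  unfold omega
  have := Real.Gamma_pos_of_pos (show 0 < 1 + r / 2 by linarith)
  positivity

lemma projConst_pos (hn : 2 ≤ n) {p : ℝ} (hp : 1 < p) : 0 < projConst n p := by
  have h2 : (2 : ℝ) ≤ n := by exact_mod_cast hn
  have h0 : 0 < omega n := omega_pos (by linarith)
  have h1 : 0 < omega ((n : ℝ) - 2 + p) := omega_pos (by linarith)
  have h3 : 0 < omega ((n : ℝ) - 2) := omega_pos (by linarith)
  have h4 : 0 < omega (p - 1) := omega_pos (by linarith)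
  have h5 : 0 < omega 2 := omega_pos (by norm_num)
  unfold projConst cConst
  positivity

/-- Pull the integral against the surface area measure back along the Gauss map, where `h_L(ν(x)) =
⟨x, ν(x)⟩` eliminates the support function. -/
lemma IsBody.projectionSupport_eq {L : Set (Euc n)} (hL : IsBody L) {p : ℝ} (v : Euc n) :
    projectionSupport p L v = (projConst n p * (energy p L v).toReal) ^ (1 / p) := by
  have hν := hL.aemeasurable_gaussMap (μHE[n - 1] : Measure (Euc n))
  unfold projectionSupport surfaceAreaMeasure projConst energy
  congr 2
  have hm : Measurable fun θ : Euc n => |⟪v, θ⟫| ^ p * supportFun L θ ^ (1 - p) := by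
    have h1 : Measurable fun θ : Euc n => |⟪v, θ⟫| := by fun_prop
    exact (h1.pow_const p).mul (hL.continuous_supportFun.measurable.pow_const _)
  rw [integral_map hν hm.aestronglyMeasurable]
  have hcongr : ∀ x ∈ regularBoundary L,
      |⟪v, gaussMap L x⟫| ^ p * supportFun L (gaussMap L x) ^ (1 - p) =
      |⟪v, gaussMap L x⟫| ^ p * ⟪x, gaussMap L x⟫ ^ (1 - p) := fun x hx => by
    rw [supportFun_eq_of_normal (hL.mem_of_regular hx) (gaussMap_spec hx)]
  rw [setIntegral_congr_fun hL.measurableSet_regularBoundary hcongr]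
  refine integral_eq_lintegral_of_nonneg_ae ?_ (hL.aemeasurable_density p _ v).aestronglyMeasurable
  filter_upwards [ae_restrict_mem hL.measurableSet_regularBoundary] with x hx
  have := hL.inner_pos_of_normal (gaussMap_spec hx)
  simp only [Pi.zero_apply]
  positivity

/-! ### The polar projection body as a sublevel set -/

/-- A sublinear `h` is the support function of its Wulff shape: if `h v > 1`, Hahn-Banach extends `c
v ↦ c h(v)` to a linear functional below `h`, whose Riesz vector `x` lies in the Wulff shape and has
`⟨x, v⟩ = h v > 1`. -/
lemma polarSet_wulff {h : Euc n → ℝ} (h_nonneg : ∀ v, 0 ≤ h v)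
    (h_hom : ∀ c : ℝ, 0 < c → ∀ v, h (c • v) = c * h v) (h_add : ∀ v w, h (v + w) ≤ h v + h w) :
    polarSet {x : Euc n | ∀ v : Euc n, ‖v‖ = 1 → ⟪x, v⟫ ≤ h v} = {v | h v ≤ 1} := by
  have h_zero : h 0 = 0 := by
    have := h_hom 2 (by norm_num) 0
    rw [smul_zero] at this; linarith
  apply Subset.antisymm
  · intro v hv
    by_contra hlt
    rw [Set.mem_ofPred_eq, not_le] at hlt
    have hv0 : v ≠ 0 := by rintro rfl; rw [h_zero] at hlt; linarith
    obtain ⟨g, hg1, hg2⟩ := exists_extension_of_le_sublinear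
      (LinearPMap.mkSpanSingleton (K := ℝ) v (h v) hv0) h h_hom h_add (by
        rintro ⟨x, hx⟩
        obtain ⟨c, rfl⟩ := Submodule.mem_span_singleton.1 hx
        rw [LinearPMap.mkSpanSingleton'_apply]
        rcases lt_trichotomy c 0 with hc | rfl | hc
        -- Homogeneity covers positive `c` only; for `c < 0` the sign of `h` suffices: `c h(v) ≤ 0 ≤
        -- h(c v)`.
        · exact (mul_nonpos_of_nonpos_of_nonneg hc.le (h_nonneg v)).trans (h_nonneg _)
        · simp [h_zero]
        · rw [h_hom c hc]; rfl)
    have hgv : g v = h v := by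
      have := hg1 ⟨v, Submodule.mem_span_singleton_self v⟩
      simp only at this
      rw [this]
      exact LinearPMap.mkSpanSingleton'_apply_self _ _ _ _
    let x : Euc n := (InnerProductSpace.toDual ℝ (Euc n)).symm (LinearMap.toContinuousLinearMap g)
    have hx : ∀ w, ⟪x, w⟫ = g w := fun w => by
      simp [x, InnerProductSpace.toDual_symm_apply]
    have := hv x fun w _ => by rw [hx]; exact hg2 w
    rw [real_inner_comm, hx, hgv] at this
    linarith
  · intro v hv x hx
    rcases eq_or_ne v 0 with rfl | hv0
    · simp
    have hpos := norm_pos_iff.2 hv0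
    have h1 := hx (‖v‖⁻¹ • v) (by rw [norm_smul, norm_inv, norm_norm, inv_mul_cancel₀ hpos.ne'])
    rw [h_hom _ (by positivity), real_inner_smul_right] at h1
    rw [real_inner_comm]
    exact (le_of_mul_le_mul_left h1 (by positivity)).trans hv

section

variable {L : Set (Euc n)} {p : ℝ}

lemma IsBody.energy_smul (hL : IsBody L) {c : ℝ} (hc : 0 < c) (v : Euc n) :
    energy p L (c • v) = ENNReal.ofReal (c ^ p) * energy p L v := by
  unfold energy
  rw [← lintegral_const_mul'' _ (hL.aemeasurable_density p _ v).ennreal_ofReal]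
  congr 1 with x
  rw [← ENNReal.ofReal_mul (by positivity), real_inner_smul_left, abs_mul, abs_of_pos hc,
    Real.mul_rpow hc.le (abs_nonneg _), mul_assoc]

/-- Minkowski's inequality in `L^p` for the functions `|⟨v, ν⟩| ⟨x, ν⟩^{(1-p)/p}`, whose `p`-th
powers are the integrands. -/
lemma IsBody.energy_add (hL : IsBody L) (hp : 1 < p) (v w : Euc n) :
    energy p L (v + w) ^ (1 / p) ≤ energy p L v ^ (1 / p) + energy p L w ^ (1 / p) := by
  have hp0 : 0 < p := by linarith
  -- The redundant exponent `1` gives `f` the shape covered by `IsBody.aemeasurable_density`.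
  let f : Euc n → Euc n → ENNReal := fun v x =>
    ENNReal.ofReal (|⟪v, gaussMap L x⟫| ^ (1 : ℝ) * ⟪x, gaussMap L x⟫ ^ ((1 - p) / p))
  have hf : ∀ v, energy p L v = ∫⁻ x in regularBoundary L, f v x ^ p ∂μHE[n - 1] := by
    intro v
    unfold energy
    refine setLIntegral_congr_fun hL.measurableSet_regularBoundary fun x hx => ?_
    have h0 := hL.inner_pos_of_normal (gaussMap_spec hx)
    simp only [f, Real.rpow_one]
    rw [ENNReal.ofReal_rpow_of_nonneg (by positivity) hp0.le,
      Real.mul_rpow (abs_nonneg _) (by positivity), ← Real.rpow_mul h0.le, div_mul_cancel₀ _ hp0.ne']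
  have hm := fun v => (hL.aemeasurable_density (1 : ℝ) ((1 - p) / p) v).ennreal_ofReal
  simp only [hf]
  refine le_trans ?_ (ENNReal.lintegral_Lp_add_le (hm v) (hm w) hp.le)
  refine ENNReal.rpow_le_rpow ?_ (by positivity)
  refine setLIntegral_mono_ae' hL.measurableSet_regularBoundary (Filter.Eventually.of_forall ?_)
  intro x hx
  have h0 := hL.inner_pos_of_normal (gaussMap_spec hx)
  refine ENNReal.rpow_le_rpow ?_ hp0.le
  simp only [f, Real.rpow_one, Pi.add_apply]
  rw [← ENNReal.ofReal_add (by positivity) (by positivity), ← add_mul, inner_add_left]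
  refine ENNReal.ofReal_le_ofReal ?_
  gcongr
  exact abs_add_le _ _

lemma IsBody.projectionSupport_eq_mul (hL : IsBody L) (hn : 2 ≤ n) (hp : 1 < p) (v : Euc n) :
    projectionSupport p L v = projConst n p ^ (1 / p) * (energy p L v ^ (1 / p)).toReal := by
  rw [hL.projectionSupport_eq, Real.mul_rpow (projConst_pos hn hp).le ENNReal.toReal_nonneg,
    ENNReal.toReal_rpow]

lemma IsBody.projectionSupport_nonneg (hL : IsBody L) (hn : 2 ≤ n) (hp : 1 < p) (v : Euc n) :
    0 ≤ projectionSupport p L v := by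
  rw [hL.projectionSupport_eq_mul hn hp]
  have := projConst_pos hn hp
  positivity

lemma IsBody.projectionSupport_smul (hL : IsBody L) (hn : 2 ≤ n) (hp : 1 < p) {c : ℝ} (hc : 0 < c)
    (v : Euc n) : projectionSupport p L (c • v) = c * projectionSupport p L v := by
  have hp0 : 0 < p := by linarith
  rw [hL.projectionSupport_eq_mul hn hp, hL.projectionSupport_eq_mul hn hp, hL.energy_smul hc,
    ENNReal.mul_rpow_of_nonneg _ _ (by positivity), ENNReal.ofReal_rpow_of_nonneg (by positivity)
    (by positivity), ← Real.rpow_mul hc.le, mul_one_div_cancel hp0.ne', Real.rpow_one,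
    ENNReal.toReal_mul, ENNReal.toReal_ofReal hc.le]
  ring

lemma IsBody.projectionSupport_add (hL : IsBody L) (hn : 2 ≤ n) (hp : 1 < p) (v w : Euc n) :
    projectionSupport p L (v + w) ≤ projectionSupport p L v + projectionSupport p L w := by
  have hp0 : 0 < p := by linarith
  have hfin : ∀ v, energy p L v ^ (1 / p) ≠ ⊤ := fun v =>
    ENNReal.rpow_ne_top_of_nonneg (by positivity) (hL.energy_lt_top (by omega) hp v).ne
  have hC := projConst_pos hn hp
  simp only [hL.projectionSupport_eq_mul hn hp]
  rw [← mul_add, ← ENNReal.toReal_add (hfin v) (hfin w)]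
  gcongr
  · exact ENNReal.add_ne_top.2 ⟨hfin v, hfin w⟩
  · exact hL.energy_add hp v w

lemma IsBody.polarProjectionBody_eq_support (hL : IsBody L) (hn : 2 ≤ n) (hp : 1 < p) :
    polarProjectionBody p L = {v | projectionSupport p L v ≤ 1} :=
  polarSet_wulff (hL.projectionSupport_nonneg hn hp)
    (fun _ hc v => hL.projectionSupport_smul hn hp hc v) (hL.projectionSupport_add hn hp)

lemma IsBody.polarProjectionBody_eq (hL : IsBody L) (hn : 2 ≤ n) (hp : 1 < p) :
    polarProjectionBody p L = {v | energy p L v ≤ ENNReal.ofReal (projConst n p)⁻¹} := by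
  have hp0 : 0 < p := by linarith
  have hC := projConst_pos hn hp
  rw [hL.polarProjectionBody_eq_support hn hp]
  ext v
  rw [Set.mem_ofPred_eq, Set.mem_ofPred_eq, hL.projectionSupport_eq,
    ← ENNReal.toReal_le_toReal (hL.energy_lt_top (by omega) hp v).ne ENNReal.ofReal_ne_top,
    ENNReal.toReal_ofReal (by positivity)]
  have h0 : 0 ≤ projConst n p * (energy p L v).toReal := by positivity
  have h1 := Real.rpow_le_rpow_iff (z := 1 / p) h0 zero_le_one (by positivity)
  rw [Real.one_rpow] at h1
  rw [h1, ← le_div_iff₀' hC, one_div]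

lemma convex_polarProjectionBody : Convex ℝ (polarProjectionBody p L) := by
  intro x hx y hy a b _ _ hab z hz
  rw [inner_add_left, real_inner_smul_left, real_inner_smul_left]
  have := hx z hz
  have := hy z hz
  nlinarith

lemma measurableSet_polarProjectionBody : MeasurableSet (polarProjectionBody p L) := by
  refine IsClosed.measurableSet ?_
  have : polarProjectionBody p L = ⋂ y ∈ projectionBody p L, {x | ⟪x, y⟫ ≤ 1} := by
    ext; simp [polarProjectionBody, polarSet]
  rw [this]
  exact isClosed_biInter fun y _ => isClosed_le (by fun_prop) (by fun_prop)

end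

variable {u : Euc n}

/-! ### Area formula for graphs -/

/-- The graph over `s ⊆ u^⊥` of a function. -/
def graphOver (u : Euc n) (f : Hyp u → ℝ) (s : Set (Hyp u)) : Set (Euc n) :=
  (fun y => pt u y (f y)) '' s

lemma graphOver_inter_preimage (f : Hyp u → ℝ) (s t : Set (Hyp u)) :
    hproj u ⁻¹' t ∩ graphOver u f s = graphOver u f (t ∩ s) := by
  ext x
  constructor
  · rintro ⟨hx, y, hy, rfl⟩
    rw [mem_preimage, hproj_pt] at hx
    exact ⟨y, ⟨hx, hy⟩, rfl⟩
  · rintro ⟨y, ⟨hy, hy'⟩, rfl⟩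
    exact ⟨by rwa [mem_preimage, hproj_pt], y, hy', rfl⟩

lemma pt_sub_pt (y z : Hyp u) (s t : ℝ) : pt u y s - pt u z t = pt u (y - z) (s - t) := by
  simp only [pt, Submodule.coe_sub]; module

lemma norm_le_norm_pt (hu : ‖u‖ = 1) (y : Hyp u) (s : ℝ) : ‖y‖ ≤ ‖pt u y s‖ :=
  le_of_sq_le_sq (by rw [norm_pt_sq hu]; nlinarith [sq_nonneg s]) (norm_nonneg _)

/-- The vertical map from the graph of `g` to that of `f` changes a difference of points only by the
increment of `f - g` along `u`, at most `δ ‖x - y‖`; so it is `(1 + δ)`-Lipschitz. -/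
lemma hausdorff_graph_le (hu : ‖u‖ = 1) {f g : Hyp u → ℝ} {s : Set (Hyp u)} {δ : NNReal}
    (h : ∀ x ∈ s, ∀ y ∈ s, |f x - f y - (g x - g y)| ≤ δ * ‖x - y‖) (d : ℕ) :
    (μHE[d] : Measure (Euc n)) (graphOver u f s) ≤
      (1 + δ : ENNReal) ^ d * (μHE[d] : Measure (Euc n)) (graphOver u g s) := by
  have him : graphOver u f s =
      (fun z => pt u (hproj u z) (f (hproj u z))) '' (graphOver u g s) := by
    rw [graphOver, graphOver, image_image]
    simp only [hproj_pt]
  have hlip : LipschitzOnWith (1 + δ) (fun z => pt u (hproj u z) (f (hproj u z)))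
      (graphOver u g s) := by
    refine LipschitzOnWith.of_dist_le_mul ?_
    rintro _ ⟨x, hx, rfl⟩ _ ⟨y, hy, rfl⟩
    simp only [hproj_pt, dist_eq_norm, pt_sub_pt]
    have h1 : pt u (x - y) (f x - f y) =
        pt u (x - y) (g x - g y) + (f x - f y - (g x - g y)) • u := by
      simp only [pt]; module
    have h2 := norm_le_norm_pt hu (x - y) (g x - g y)
    rw [h1]
    refine (norm_add_le _ _).trans ?_
    rw [norm_smul, hu, mul_one, Real.norm_eq_abs]
    have h3 := h x hx y hy
    have h4 : (δ : ℝ) * ‖x - y‖ ≤ δ * ‖pt u (x - y) (g x - g y)‖ := by gcongr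
    push_cast
    linarith
  rw [him]
  simpa using hlip.euclideanHausdorffMeasure_image_le d

/-- The graph map `y ↦ (y, a y)` factors as a linear map `B` of `u^⊥` followed by an isometry, so
the area factor is `det B`. Here `B` is the positive square root of `I + b ⊗ b`, with `b` the Riesz
vector of `a`. -/
lemma hausdorff_graph_linear (hu : ‖u‖ = 1) (a : Hyp u →L[ℝ] ℝ) (s : Set (Hyp u)) :
    (μHE[n - 1] : Measure (Euc n)) (graphOver u a s) =
      ENNReal.ofReal (√(1 + ‖a‖ ^ 2)) * volume s := by
  let b : Hyp u := (InnerProductSpace.toDual ℝ (Hyp u)).symm a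
  have hb : ∀ y, a y = ⟪b, y⟫ := fun y => by simp [b]
  have hnb : ‖b‖ = ‖a‖ := by simp [b]
  set r := √(1 + ‖a‖ ^ 2) with hr
  have hr0 : 0 ≤ r := Real.sqrt_nonneg _
  have hr2 : r ^ 2 = 1 + ‖a‖ ^ 2 := Real.sq_sqrt (by positivity)
  -- The positive root of `2k + k² ‖a‖² = 1` when `a ≠ 0`; this equation says `‖y + k (a y) b‖² =
  -- ‖y‖² + (a y)²`.
  let k : ℝ := 1 / (1 + r)
  have hk : k * (1 + r) = 1 := by simp only [k]; field_simp
  have hka : 1 + k * ‖a‖ ^ 2 = r := by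
    have : ‖a‖ ^ 2 = (r - 1) * (1 + r) := by linarith
    rw [this]; linear_combination (r - 1) * hk
  let B : Hyp u →ₗ[ℝ] Hyp u := LinearMap.transvection (k • a.toLinearMap) b
  have hdet : LinearMap.det B = r := by
    rw [LinearMap.transvection.det]
    have : a b = ‖a‖ ^ 2 := by rw [hb, real_inner_self_eq_norm_sq, hnb]
    simp [this, hka]
  have hBy : ∀ y, B y = y + (k * a y) • b := fun y => by
    simp [B, LinearMap.transvection.apply]
  have hdet0 : LinearMap.det B ≠ 0 := by
    rw [hdet]; nlinarith [sq_nonneg ‖a‖]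
  let e : Hyp u ≃ₗ[ℝ] Hyp u := B.equivOfDetNeZero hdet0
  have he : ∀ y, e y = B y := fun y => rfl
  have hnorm : ∀ y, ‖pt u y (a y)‖ = ‖B y‖ := by
    intro y
    rw [← sq_eq_sq₀ (norm_nonneg _) (norm_nonneg _), norm_pt_sq hu, hBy, norm_add_sq_real,
      real_inner_smul_right, norm_smul, mul_pow, hnb, real_inner_comm, ← hb, Real.norm_eq_abs,
      sq_abs]
    have : 2 * k + k ^ 2 * ‖a‖ ^ 2 = 1 := by
      linear_combination k * hka + hk
    linear_combination (-(a y) ^ 2) * this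
  have hiso : Isometry (fun z => pt u (e.symm z) (a (e.symm z))) := by
    refine Isometry.of_dist_eq fun z w => ?_
    rw [dist_eq_norm, dist_eq_norm, pt_sub_pt, ← map_sub a, ← map_sub e.symm, hnorm, ← he,
      e.apply_symm_apply]
  have him : graphOver u a s = (fun z => pt u (e.symm z) (a (e.symm z))) '' (B '' s) := by
    rw [image_image]
    simp only [← he, e.symm_apply_apply]
    rfl
  rw [him, hiso.euclideanHausdorffMeasure_image, volume_hyp hu, Measure.addHaar_image_linearMap,
    hdet, abs_of_nonneg hr0]

/-- Locally `f` is `K`-Lipschitz, that is, `K`-close to the zero map, whose graph over a null set is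
null. -/
lemma hausdorff_graph_null (hu : ‖u‖ = 1) {f : Hyp u → ℝ} {U : Set (Hyp u)}
    (hf : LocallyLipschitzOn U f) {N : Set (Hyp u)} (hNU : N ⊆ U) (hN : volume N = 0) :
    (μHE[n - 1] : Measure (Euc n)) (graphOver u f N) = 0 := by
  refine measure_null_of_locally_null _ ?_
  rintro _ ⟨y, hy, rfl⟩
  obtain ⟨K, t, ht, hK⟩ := hf (hNU hy)
  obtain ⟨V, hV, hVt⟩ := mem_nhdsWithin_iff_exists_mem_nhds_inter.1 ht
  refine ⟨hproj u ⁻¹' V ∩ graphOver u f N, ?_, ?_⟩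
  · rw [inter_comm]
    refine inter_mem_nhdsWithin _ ((hproj u).continuous.continuousAt.preimage_mem_nhds ?_)
    simpa only [hproj_pt] using hV
  · rw [graphOver_inter_preimage, ← nonpos_iff_eq_zero]
    have h := hausdorff_graph_le hu (f := f) (g := (0 : Hyp u →L[ℝ] ℝ)) (s := V ∩ N) (δ := K)
      (fun x hx z hz => by
        have := hK.dist_le_mul x (hVt ⟨hx.1, hNU hx.2⟩) z (hVt ⟨hz.1, hNU hz.2⟩)
        simpa [Real.dist_eq, dist_eq_norm] using this) (n - 1)
    refine h.trans ?_
    rw [hausdorff_graph_linear hu, measure_mono_null inter_subset_right hN]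
    simp

lemma ae_differentiableAt_of_locallyLipschitzOn {f : Hyp u → ℝ} {U : Set (Hyp u)} (hU : IsOpen U)
    (hf : LocallyLipschitzOn U f) : volume (U \ {y | DifferentiableAt ℝ f y}) = 0 := by
  refine measure_null_of_locally_null _ ?_
  rintro y ⟨hy, -⟩
  obtain ⟨K, t, ht, hK⟩ := hf hy
  rw [hU.nhdsWithin_eq hy] at ht
  obtain ⟨V, hVt, hV, hyV⟩ := mem_nhds_iff.1 ht
  refine ⟨V \ {y | DifferentiableAt ℝ f y}, ?_, ?_⟩
  · have : V ∩ (U \ {y | DifferentiableAt ℝ f y}) ⊆ V \ {y | DifferentiableAt ℝ f y} :=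
      fun z hz => ⟨hz.1, hz.2.2⟩
    exact Filter.mem_of_superset (Filter.inter_mem (mem_nhdsWithin_of_mem_nhds (hV.mem_nhds hyV))
      self_mem_nhdsWithin) this
  · have h := (hK.mono hVt).ae_differentiableWithinAt_of_mem (μ := (volume : Measure (Hyp u)))
    refine measure_mono_null ?_ h
    rintro z ⟨hz, hz'⟩ hc
    exact hz' ((hc hz).differentiableAt (hV.mem_nhds hz))

lemma sqrt_one_add_sq_le {a b δ : ℝ} (ha : 0 ≤ a) (hab : a ≤ b + δ) (hδ : 0 ≤ δ) :
    √(1 + a ^ 2) ≤ (1 + δ) * √(1 + b ^ 2) := by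
  rw [← Real.sqrt_sq (show 0 ≤ 1 + δ by positivity), ← Real.sqrt_mul (by positivity)]
  refine Real.sqrt_le_sqrt ?_
  have h1 : a ^ 2 ≤ (b + δ) ^ 2 := by gcongr
  nlinarith [mul_nonneg hδ (sq_nonneg (b - 1)), mul_nonneg hδ (sq_nonneg b),
    mul_nonneg (sq_nonneg δ) (sq_nonneg b)]

lemma measure_le_of_partition {α : Type*} [MeasurableSpace α] {μ ν : Measure α} {C : ENNReal}
    {s : Set α} {t : ℕ → Set α} (hs : MeasurableSet s) (ht : ∀ k, MeasurableSet (t k))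
    (hd : Pairwise (Function.onFun Disjoint t)) (hst : s ⊆ ⋃ k, t k)
    (h : ∀ k, μ (s ∩ t k) ≤ C * ν (s ∩ t k)) : μ s ≤ C * ν s := by
  have hs' : s = ⋃ k, s ∩ t k := by rw [← inter_iUnion, inter_eq_left.2 hst]
  calc μ s ≤ ∑' k, μ (s ∩ t k) := by
        conv_lhs => rw [hs']
        exact measure_iUnion_le _
    _ ≤ ∑' k, C * ν (s ∩ t k) := ENNReal.tsum_le_tsum h
    _ = C * ν s := by
        rw [ENNReal.tsum_mul_left, ← measure_iUnion
          (fun i j hij => (hd hij).mono inter_subset_right inter_subset_right)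
          (fun k => hs.inter (ht k)), ← hs']

/-- The pushforward to `u^⊥` of the surface measure on the graph of `f` over `U`. -/
def graphMeasure (u : Euc n) (f : Hyp u → ℝ) (U : Set (Hyp u)) : Measure (Hyp u) :=
  ((μHE[n - 1] : Measure (Euc n)).restrict (graphOver u f U)).map (hproj u)

/-- The area density of the graph of `f`. -/
def areaDensity (f : Hyp u → ℝ) (y : Hyp u) : ENNReal := ENNReal.ofReal (√(1 + ‖fderiv ℝ f y‖ ^ 2))

lemma measurable_areaDensity (f : Hyp u → ℝ) : Measurable (areaDensity f) := by
  have h := (measurable_fderiv ℝ f).norm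
  exact ((h.pow_const 2).const_add 1).sqrt.ennreal_ofReal

lemma graphMeasure_apply (f : Hyp u → ℝ) (U : Set (Hyp u)) {s : Set (Hyp u)}
    (hs : MeasurableSet s) :
    graphMeasure u f U s = (μHE[n - 1] : Measure (Euc n)) (graphOver u f (s ∩ U)) := by
  have hm : Measurable (hproj u) := (hproj u).continuous.measurable
  rw [graphMeasure, Measure.map_apply hm hs, Measure.restrict_apply (hm hs),
    graphOver_inter_preimage]

/-- Compare with the graph of the linear map `a`. The Hausdorff measures differ by at most `(1 +
δ)^{n-1}` and the densities by at most one more factor `1 + δ`. -/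
lemma graph_piece_bounds (hu : ‖u‖ = 1) {f : Hyp u → ℝ} {s : Set (Hyp u)} (hs : MeasurableSet s)
    {a : Hyp u →L[ℝ] ℝ} {δ : NNReal} (ha : ApproximatesLinearOn f a s δ)
    (hd : ∀ y ∈ s, ‖fderiv ℝ f y - a‖ ≤ δ) :
    (μHE[n - 1] : Measure (Euc n)) (graphOver u f s) ≤
      (1 + δ : ENNReal) ^ n * ∫⁻ y in s, areaDensity f y ∧
    ∫⁻ y in s, areaDensity f y ≤
      (1 + δ : ENNReal) ^ n * (μHE[n - 1] : Measure (Euc n)) (graphOver u f s) := by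
  -- The subtraction is truncated; a unit vector exists only if `n > 0`.
  have hn : n - 1 + 1 = n := by
    rcases Nat.eq_zero_or_pos n with rfl | h
    · rw [Subsingleton.elim u 0, norm_zero] at hu; exact absurd hu zero_ne_one
    · omega
  have hδ : (1 + δ : ENNReal) = ENNReal.ofReal (1 + δ) := by
    rw [ENNReal.ofReal_add zero_le_one δ.coe_nonneg]; simp
  have hx : ∀ x ∈ s, ∀ y ∈ s, |f x - f y - (a x - a y)| ≤ δ * ‖x - y‖ := fun x hx y hy => by
    rw [← map_sub]; exact ha x hx y hy
  have hx' : ∀ x ∈ s, ∀ y ∈ s, |a x - a y - (f x - f y)| ≤ δ * ‖x - y‖ := fun x h y h' => by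
    rw [abs_sub_comm]; exact hx x h y h'
  have h1 := hausdorff_graph_le hu hx (n - 1)
  have h2 := hausdorff_graph_le hu (f := a) hx' (n - 1)
  rw [hausdorff_graph_linear hu] at h1 h2
  have h3 : ENNReal.ofReal (√(1 + ‖a‖ ^ 2)) * volume s ≤
      (1 + δ : ENNReal) * ∫⁻ y in s, areaDensity f y := by
    rw [← lintegral_const_mul _ (measurable_areaDensity f), ← setLIntegral_const]
    refine setLIntegral_mono' hs fun y hy => ?_
    rw [areaDensity, hδ, ← ENNReal.ofReal_mul (by positivity)]
    refine ENNReal.ofReal_le_ofReal (sqrt_one_add_sq_le (by positivity) ?_ δ.coe_nonneg)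
    have := (abs_le.1 (abs_norm_sub_norm_le (fderiv ℝ f y) a)).1
    linarith [hd y hy]
  have h4 : ∫⁻ y in s, areaDensity f y ≤
      (1 + δ : ENNReal) * (ENNReal.ofReal (√(1 + ‖a‖ ^ 2)) * volume s) := by
    rw [← mul_assoc, ← setLIntegral_const]
    refine setLIntegral_mono' hs fun y hy => ?_
    rw [areaDensity, hδ, ← ENNReal.ofReal_mul (by positivity)]
    refine ENNReal.ofReal_le_ofReal (sqrt_one_add_sq_le (by positivity) ?_ δ.coe_nonneg)
    have := norm_sub_norm_le (fderiv ℝ f y) a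
    linarith [hd y hy]
  constructor
  · refine (h1.trans (mul_le_mul_right h3 _)).trans_eq ?_
    rw [← mul_assoc, ← pow_succ, hn]
  · refine (h4.trans (mul_le_mul_right h2 _)).trans_eq ?_
    rw [← mul_assoc, ← pow_succ', hn]

/-- Two nested partitions. The inner one makes `f` nearly linear, but controls its approximating
maps only by making each the derivative at some point of the set. The outer one, into pieces where
the derivative stays in a ball of radius `δ/2`, therefore brings them within `δ` of every derivative
on the piece. -/
lemma graph_bounds (hu : ‖u‖ = 1) {f : Hyp u → ℝ} {U s : Set (Hyp u)} (hs : MeasurableSet s)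
    (hsU : s ⊆ U) (hsd : ∀ y ∈ s, DifferentiableAt ℝ f y) {δ : NNReal} (hδ : 0 < δ) :
    graphMeasure u f U s ≤
      (1 + δ : ENNReal) ^ n * (volume.withDensity (areaDensity f)) s ∧
    (volume.withDensity (areaDensity f)) s ≤ (1 + δ : ENNReal) ^ n * graphMeasure u f U s := by
  obtain ⟨a, ha⟩ := TopologicalSpace.exists_dense_seq (Hyp u →L[ℝ] ℝ)
  let S : ℕ → Set (Hyp u) := disjointed fun k => fderiv ℝ f ⁻¹' Metric.ball (a k) (δ / 2)
  have hSm : ∀ k, MeasurableSet (S k) := MeasurableSet.disjointed fun k =>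
    measurable_fderiv ℝ f Metric.isOpen_ball.measurableSet
  have hScov : s ⊆ ⋃ k, S k := by
    rw [iUnion_disjointed]
    intro y _
    have hδ2 : (0 : ℝ) < δ / 2 := by positivity
    obtain ⟨k, hz⟩ := ha.exists_dist_lt (fderiv ℝ f y) hδ2
    exact mem_iUnion.2 ⟨k, hz⟩
  have hSd := disjoint_disjointed fun k => fderiv ℝ f ⁻¹' Metric.ball (a k) ((δ : ℝ) / 2)
  have hSball : ∀ k, ∀ y ∈ S k, fderiv ℝ f y ∈ Metric.ball (a k) ((δ : ℝ) / 2) := fun k y hy =>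
    disjointed_subset _ k hy
  have key : ∀ k, graphMeasure u f U (s ∩ S k) ≤
      (1 + δ : ENNReal) ^ n * (volume.withDensity (areaDensity f)) (s ∩ S k) ∧
      (volume.withDensity (areaDensity f)) (s ∩ S k) ≤
        (1 + δ : ENNReal) ^ n * graphMeasure u f U (s ∩ S k) := by
    intro k
    have hm := hs.inter (hSm k)
    rcases (s ∩ S k).eq_empty_or_nonempty with h | hne
    · simp [h]
    obtain ⟨t, A, htd, htm, htc, htA, htA'⟩ := exists_partition_approximatesLinearOn_of_hasFDerivWithinAt
      f (s ∩ S k) (fderiv ℝ f) (fun y hy => (hsd y hy.1).hasFDerivAt.hasFDerivWithinAt)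
      (fun _ => δ) (fun _ => hδ.ne')
    have hb : ∀ j, ∀ y ∈ s ∩ S k ∩ t j, ‖fderiv ℝ f y - A j‖ ≤ δ := by
      intro j y hy
      obtain ⟨z, hz, hzA⟩ := htA' hne j
      have h1 := hSball k y hy.1.2
      have h2 := hSball k z hz.2
      rw [hzA]
      refine (dist_eq_norm (fderiv ℝ f y) (fderiv ℝ f z)).symm.trans_le ?_
      refine (dist_triangle_right _ _ (a k)).trans ?_
      rw [Metric.mem_ball] at h1 h2
      linarith
    have hp := fun j => graph_piece_bounds hu (hm.inter (htm j)) (htA j) (hb j)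
    have e1 : ∀ j, graphMeasure u f U (s ∩ S k ∩ t j) =
        (μHE[n - 1] : Measure (Euc n)) (graphOver u f (s ∩ S k ∩ t j)) := fun j => by
      rw [graphMeasure_apply _ _ (hm.inter (htm j)), inter_eq_left.2]
      exact fun y hy => hsU hy.1.1
    have e2 : ∀ j, (volume.withDensity (areaDensity f)) (s ∩ S k ∩ t j) =
        ∫⁻ y in s ∩ S k ∩ t j, areaDensity f y := fun j => withDensity_apply _ (hm.inter (htm j))
    exact ⟨measure_le_of_partition hm htm htd htc fun j => by rw [e1, e2]; exact (hp j).1,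
      measure_le_of_partition hm htm htd htc fun j => by rw [e1, e2]; exact (hp j).2⟩
  exact ⟨measure_le_of_partition hs hSm hSd hScov fun k => (key k).1,
    measure_le_of_partition hs hSm hSd hScov fun k => (key k).2⟩

lemma le_of_forall_one_add_pow_mul {x y : ENNReal} (m : ℕ)
    (h : ∀ δ : NNReal, 0 < δ → x ≤ (1 + δ : ENNReal) ^ m * y) : x ≤ y := by
  have h1 : Filter.Tendsto (fun δ : NNReal => (1 + δ : ENNReal) ^ m * y)
      (nhdsWithin 0 (Ioi 0)) (nhds ((1 + (0 : NNReal) : ENNReal) ^ m * y)) := by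
    refine ENNReal.Tendsto.mul_const ?_ (Or.inl (by simp))
    refine Filter.Tendsto.mono_left ?_ nhdsWithin_le_nhds
    have : Continuous fun δ : NNReal => (1 + δ : ENNReal) ^ m := by fun_prop
    exact this.tendsto 0
  rw [ENNReal.coe_zero, add_zero, one_pow, one_mul] at h1
  have : (nhdsWithin (0 : NNReal) (Ioi 0)).NeBot := nhdsGT_neBot 0
  exact ge_of_tendsto h1 (Filter.eventually_of_mem self_mem_nhdsWithin fun δ hδ => h δ hδ)

/-- **Area formula** for the graph of a locally Lipschitz function over an open set. -/
theorem graphMeasure_eq (hu : ‖u‖ = 1) {f : Hyp u → ℝ} {U : Set (Hyp u)} (hU : IsOpen U)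
    (hf : LocallyLipschitzOn U f) :
    graphMeasure u f U = (volume.restrict U).withDensity (areaDensity f) := by
  ext s hs
  set D : Set (Hyp u) := {y | DifferentiableAt ℝ f y}
  have hD : MeasurableSet D := measurableSet_of_differentiableAt ℝ f
  have hnull := ae_differentiableAt_of_locallyLipschitzOn hU hf
  have hm : MeasurableSet (s ∩ U ∩ D) := (hs.inter hU.measurableSet).inter hD
  have hsub : (s ∩ U) \ (s ∩ U ∩ D) ⊆ U \ D := fun y hy => ⟨hy.1.2, fun h => hy.2 ⟨hy.1, h⟩⟩
  have h1 : graphMeasure u f U s = graphMeasure u f U (s ∩ U ∩ D) := by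
    have : graphMeasure u f U s = graphMeasure u f U (s ∩ U) := by
      rw [graphMeasure_apply _ _ hs, graphMeasure_apply _ _ (hs.inter hU.measurableSet),
        inter_assoc, inter_self]
    rw [this]
    refine (measure_eq_measure_of_null_sdiff inter_subset_left ?_).symm
    rw [graphMeasure_apply _ _ ((hs.inter hU.measurableSet).diff hm)]
    exact hausdorff_graph_null hu hf inter_subset_right
      (measure_mono_null (inter_subset_left.trans hsub) hnull)
  have h2 : (volume.restrict U).withDensity (areaDensity f) s =
      (volume.withDensity (areaDensity f)) (s ∩ U ∩ D) := by
    rw [← restrict_withDensity hU.measurableSet, Measure.restrict_apply hs]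
    refine (measure_eq_measure_of_null_sdiff inter_subset_left ?_).symm
    exact withDensity_absolutelyContinuous _ _ (measure_mono_null hsub hnull)
  rw [h1, h2]
  have hb := fun δ hδ => graph_bounds hu (δ := δ) hm (fun y hy => hy.1.2) (fun y hy => hy.2) hδ
  exact le_antisymm (le_of_forall_one_add_pow_mul n fun δ hδ => (hb δ hδ).1)
    (le_of_forall_one_add_pow_mul n fun δ hδ => (hb δ hδ).2)

/-! ### The shadow and the upper boundary function of a convex body -/

lemma exists_unit_support {E : Type*} [NormedAddCommGroup E] [InnerProductSpace ℝ E]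
    [CompleteSpace E] {P : Set E} (hP : Convex ℝ P) (hne : (interior P).Nonempty) {y : E}
    (hy : y ∉ interior P) : ∃ w : E, ‖w‖ = 1 ∧ ∀ z ∈ P, ⟪z, w⟫ ≤ ⟪y, w⟫ := by
  obtain ⟨f, hf⟩ := geometric_hahn_banach_open_point hP.interior isOpen_interior hy
  let b : E := (InnerProductSpace.toDual ℝ E).symm f
  have hb : ∀ z, ⟪z, b⟫ = f z := fun z => by rw [real_inner_comm]; simp [b]
  have hb0 : b ≠ 0 := by
    rintro h
    obtain ⟨z, hz⟩ := hne
    have := hf z hz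
    rw [← hb, ← hb, h, inner_zero_right, inner_zero_right] at this
    exact lt_irrefl _ this
  have hle : ∀ z ∈ P, f z ≤ f y := by
    intro z hz
    have hz' : z ∈ closure (interior P) := by
      rw [hP.closure_interior_eq_closure_of_nonempty_interior hne]; exact subset_closure hz
    exact closure_minimal (fun x hx => (hf x hx).le)
      (isClosed_le f.continuous continuous_const) hz'
  have hpos := norm_pos_iff.2 hb0
  refine ⟨‖b‖⁻¹ • b, by rw [norm_smul, norm_inv, norm_norm, inv_mul_cancel₀ hpos.ne'], ?_⟩
  intro z hz
  rw [real_inner_smul_right, real_inner_smul_right, hb, hb]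
  have := hle z hz
  gcongr

/-- The orthogonal projection of `L` to `u^⊥`. -/
def shadow (u : Euc n) (L : Set (Euc n)) : Set (Hyp u) := hproj u '' L

/-- The function on `u^⊥` whose graph is the upper boundary of `L` in direction `u`. -/
def topFun (u : Euc n) (L : Set (Euc n)) (y : Hyp u) : ℝ := sSup (lineSection L u y)

lemma mem_lineSection {L : Set (Euc n)} {y : Hyp u} {s : ℝ} :
    s ∈ lineSection L u y ↔ pt u y s ∈ L := Iff.rfl

section body

variable {L : Set (Euc n)}

lemma hproj_mem_shadow {x : Euc n} (hx : x ∈ L) : hproj u x ∈ shadow u L :=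
  mem_image_of_mem _ hx

lemma mem_shadow_of_pt {y : Hyp u} {s : ℝ} (h : pt u y s ∈ L) : y ∈ shadow u L :=
  ⟨_, h, hproj_pt y s⟩

lemma exists_pt_of_mem_shadow (hu : ‖u‖ = 1) {y : Hyp u} (hy : y ∈ shadow u L) :
    ∃ s, pt u y s ∈ L := by
  obtain ⟨x, hx, rfl⟩ := hy
  exact ⟨⟪x, u⟫, by rwa [pt_hproj hu]⟩

lemma IsBody.convex_shadow (hL : IsBody L) : Convex ℝ (shadow u L) :=
  hL.convex.linear_image (hproj u).toLinearMap

lemma IsBody.isCompact_shadow (hL : IsBody L) : IsCompact (shadow u L) :=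
  hL.compact.image (hproj u).continuous

lemma IsBody.zero_mem_interior_shadow (hL : IsBody L) : (0 : Hyp u) ∈ interior (shadow u L) := by
  obtain ⟨r, hr, h⟩ := hL.exists_closedBall_subset
  refine mem_interior_iff_mem_nhds.2 (Filter.mem_of_superset (Metric.closedBall_mem_nhds _ hr) ?_)
  intro y hy
  refine mem_shadow_of_pt (s := 0) (h ?_)
  simpa [pt] using hy

lemma IsBody.isCompact_lineSection (hL : IsBody L) (hu : ‖u‖ = 1) (y : Hyp u) :
    IsCompact (lineSection L u y) := by
  have : lineSection L u y = (fun x => ⟪x, u⟫) '' (L ∩ hproj u ⁻¹' {y}) := by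
    ext s
    constructor
    · intro hs
      exact ⟨pt u y s, ⟨hs, hproj_pt y s⟩, inner_pt_u hu y s⟩
    · rintro ⟨x, ⟨hx, hy⟩, rfl⟩
      rw [mem_lineSection, ← show hproj u x = y from hy]
      simp only [pt_hproj hu]; exact hx
  rw [this]
  exact (hL.compact.inter_right (isClosed_singleton.preimage (hproj u).continuous)).image
    (by fun_prop)

lemma IsBody.convex_lineSection (hL : IsBody L) (y : Hyp u) :
    Convex ℝ (lineSection L u y) := by
  intro s hs t ht a b ha hb hab
  rw [mem_lineSection] at *
  have := hL.convex hs ht ha hb hab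
  rw [pt_smul, pt_smul, pt_add, ← add_smul, hab, one_smul] at this
  exact this

lemma IsBody.isGreatest_topFun (hL : IsBody L) (hu : ‖u‖ = 1) {y : Hyp u}
    (hy : y ∈ shadow u L) : IsGreatest (lineSection L u y) (topFun u L y) :=
  (hL.isCompact_lineSection hu y).isGreatest_sSup (exists_pt_of_mem_shadow hu hy)

lemma IsBody.pt_topFun_mem (hL : IsBody L) (hu : ‖u‖ = 1) {y : Hyp u}
    (hy : y ∈ shadow u L) : pt u y (topFun u L y) ∈ L := (hL.isGreatest_topFun hu hy).1

lemma IsBody.le_topFun (hL : IsBody L) (hu : ‖u‖ = 1) {y : Hyp u} {s : ℝ} (h : pt u y s ∈ L) :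
    s ≤ topFun u L y := (hL.isGreatest_topFun hu (mem_shadow_of_pt h)).2 h

lemma IsBody.concaveOn_topFun (hL : IsBody L) (hu : ‖u‖ = 1) :
    ConcaveOn ℝ (shadow u L) (topFun u L) := by
  refine ⟨hL.convex_shadow, fun y hy z hz a b ha hb hab => hL.le_topFun hu ?_⟩
  have := hL.convex (hL.pt_topFun_mem hu hy) (hL.pt_topFun_mem hu hz) ha hb hab
  rwa [pt_smul, pt_smul, pt_add] at this

lemma IsBody.locallyLipschitzOn_topFun (hL : IsBody L) (hu : ‖u‖ = 1) :
    LocallyLipschitzOn (interior (shadow u L)) (topFun u L) :=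
  (hL.concaveOn_topFun hu).locallyLipschitzOn_interior

/-- Some `t • y` with `t > 1` is still in the shadow, so `y` is a proper convex combination of it
and `0`; mixing a point over `t • y` with `±r u` gives a nondegenerate vertical segment over `y`. -/
lemma IsBody.exists_lt_topFun (hL : IsBody L) (hu : ‖u‖ = 1) {y : Hyp u}
    (hy : y ∈ interior (shadow u L)) : ∃ s < topFun u L y, pt u y s ∈ L := by
  obtain ⟨r, hr, h⟩ := hL.exists_closedBall_subset
  have hev : ∀ᶠ t : ℝ in nhds 1, t • y ∈ shadow u L := by
    have hc : Filter.Tendsto (fun t : ℝ => t • y) (nhds 1) (nhds ((1 : ℝ) • y)) :=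
      (continuous_id.smul continuous_const).tendsto 1
    rw [one_smul] at hc
    exact hc (mem_interior_iff_mem_nhds.1 hy)
  obtain ⟨t, ht, ht1⟩ := ((hev.filter_mono nhdsWithin_le_nhds).and
    (self_mem_nhdsWithin : Ioi (1 : ℝ) ∈ nhdsWithin 1 (Ioi 1))).exists
  have ht0 : 0 < t := by linarith
  obtain ⟨s, hs⟩ := exists_pt_of_mem_shadow hu ht
  have hit : t⁻¹ < 1 := inv_lt_one_of_one_lt₀ ht1
  have key : ∀ c, |c| ≤ r → pt u y (t⁻¹ * s + (1 - t⁻¹) * c) ∈ L := by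
    intro c hc
    have h0 : pt u (0 : Hyp u) c ∈ L := h (by simpa [pt, norm_smul, hu] using hc)
    have := hL.convex hs h0 (inv_nonneg.2 ht0.le) (by linarith : 0 ≤ 1 - t⁻¹) (by ring)
    rwa [pt_smul, pt_smul, pt_add, smul_smul, inv_mul_cancel₀ ht0.ne', one_smul, smul_zero,
      add_zero] at this
  refine ⟨_, lt_of_lt_of_le ?_ (hL.le_topFun hu (key r (by rw [abs_of_pos hr]))),
    key (-r) (by rw [abs_neg, abs_of_pos hr])⟩
  have : 0 < (1 - t⁻¹) * r := mul_pos (by linarith) hr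
  linarith

lemma isOuterUnitNormal_hyp {y w : Hyp u} {s : ℝ} (hw : ‖w‖ = 1) :
    IsOuterUnitNormal L (pt u y s) (w : Euc n) ↔ ∀ z ∈ shadow u L, ⟪z, w⟫ ≤ ⟪y, w⟫ := by
  have hin : ∀ x : Euc n, ⟪x, (w : Euc n)⟫ = ⟪hproj u x, w⟫ := fun x => by
    rw [hproj, ← Submodule.inner_orthogonalProjectionOnto_eq_of_mem_right]
  unfold IsOuterUnitNormal
  rw [hin, hproj_pt]
  constructor
  · rintro ⟨-, h⟩ _ ⟨x, hx, rfl⟩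
    rw [← hin]; exact h x hx
  · refine fun h => ⟨hw, fun x hx => ?_⟩
    rw [hin]; exact h _ (hproj_mem_shadow hx)

/-- Otherwise a supporting normal of the shadow would be a horizontal normal of `L` at `x`, hence
the Gauss image by uniqueness. -/
lemma IsBody.hproj_mem_interior_of_pos (hL : IsBody L) (hu : ‖u‖ = 1) {x : Euc n}
    (hx : x ∈ regularBoundary L) (hν : ⟪gaussMap L x, u⟫ ≠ 0) :
    hproj u x ∈ interior (shadow u L) := by
  by_contra hcon
  obtain ⟨w, hw, hwP⟩ := exists_unit_support hL.convex_shadow ⟨0, hL.zero_mem_interior_shadow⟩ hcon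
  have := gaussMap_eq hx (by
    rw [← pt_hproj hu x]
    exact (isOuterUnitNormal_hyp hw).2 hwP)
  rw [this, inner_hyp_left] at hν
  exact hν rfl

lemma IsBody.inner_eq_topFun_of_pos (hL : IsBody L) (hu : ‖u‖ = 1) {x v : Euc n}
    (hx : x ∈ L) (hv : IsOuterUnitNormal L x v) (hν : 0 < ⟪v, u⟫) :
    ⟪x, u⟫ = topFun u L (hproj u x) := by
  have hm : pt u (hproj u x) ⟪x, u⟫ ∈ L := by rwa [pt_hproj hu]
  refine le_antisymm (hL.le_topFun hu hm) ?_
  have h := hv.2 _ (hL.pt_topFun_mem hu (hproj_mem_shadow hx))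
  conv_rhs at h => rw [← pt_hproj hu x]
  simp only [pt, inner_add_left, real_inner_smul_left, add_le_add_iff_left] at h
  rw [real_inner_comm v u] at h
  exact le_of_mul_le_mul_right h hν

/-- At a point of differentiability of the upper boundary function the outer unit normal is
unique. -/
lemma IsBody.normal_of_differentiableAt (hL : IsBody L) (hu : ‖u‖ = 1) {y : Hyp u}
    (hy : y ∈ interior (shadow u L)) (hd : DifferentiableAt ℝ (topFun u L) y) :
    pt u y (topFun u L y) ∈ regularBoundary L ∧ ∀ z : Hyp u, ∀ c : ℝ,
      ⟪pt u z c, gaussMap L (pt u y (topFun u L y))⟫ =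
        (√(1 + ‖fderiv ℝ (topFun u L) y‖ ^ 2))⁻¹ * (c - fderiv ℝ (topFun u L) y z) := by
  set f := topFun u L
  set r := √(1 + ‖fderiv ℝ f y‖ ^ 2) with hr
  let g : Hyp u := (InnerProductSpace.toDual ℝ (Hyp u)).symm (fderiv ℝ f y)
  have hg : ∀ z, ⟪z, g⟫ = fderiv ℝ f y z := fun z => by rw [real_inner_comm]; simp [g]
  have hng : ‖g‖ = ‖fderiv ℝ f y‖ := by simp [g]
  have hyP : y ∈ shadow u L := interior_subset hy
  have hxL := hL.pt_topFun_mem hu hyP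
  have hform : ∀ v, IsOuterUnitNormal L (pt u y (f y)) v → v = r⁻¹ • pt u (-g) 1 := by
    intro v hv
    set v' := hproj u v
    set c := ⟪v, u⟫
    have hvpt : v = pt u v' c := (pt_hproj hu v).symm
    -- A normal `(v', c)` is maximized over `L` at the given point, in particular along the graph of
    -- `f`; the vanishing derivative gives `v' = -c ∇f(y)`.
    have hmax : IsLocalMax (fun z : Hyp u => ⟪z, v'⟫ + f z * c) y := by
      filter_upwards [mem_interior_iff_mem_nhds.1 hy] with z hz
      have := hv.2 _ (hL.pt_topFun_mem hu hz)
      rwa [hvpt, inner_pt_pt hu, inner_pt_pt hu] at this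
    have hder : HasFDerivAt (fun z : Hyp u => ⟪z, v'⟫ + f z * c)
        (innerSL ℝ v' + c • fderiv ℝ f y) y := by
      have h1 : HasFDerivAt (fun z : Hyp u => ⟪z, v'⟫) (innerSL ℝ v') y := by
        have := (innerSL ℝ v').hasFDerivAt (x := y)
        refine this.congr_of_eventuallyEq (Filter.Eventually.of_forall fun z => ?_)
        simp [real_inner_comm]
      exact h1.add (hd.hasFDerivAt.mul_const c)
    have h0 := hmax.hasFDerivAt_eq_zero hder
    have hv' : v' = -(c • g) := by
      refine ext_inner_left ℝ fun z => ?_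
      have := congrArg (fun A => A z) h0
      simp only [add_apply, innerSL_apply_apply, smul_apply,
        zero_apply, smul_eq_mul] at this
      rw [inner_neg_right, real_inner_smul_right, hg, real_inner_comm]
      linarith
    have hvc : v = c • pt u (-g) 1 := by
      rw [hvpt, hv', pt_smul, mul_one, smul_neg]
    -- A strictly lower point of `L` over `y` excludes the opposite sign.
    have hc0 : 0 ≤ c := by
      obtain ⟨s, hs, hsL⟩ := hL.exists_lt_topFun hu hy
      have := hv.2 _ hsL
      rw [hvpt, inner_pt_pt hu, inner_pt_pt hu] at this
      by_contra hneg
      nlinarith [mul_pos (sub_pos.2 hs) (neg_pos.2 (not_le.1 hneg))]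
    have hn : ‖pt u (-g) 1‖ = r := by
      rw [hr, ← hng, ← norm_neg g, ← Real.sqrt_sq (norm_nonneg (pt u (-g) 1)), norm_pt_sq hu]
      congr 1; ring
    have hcr : c * r = 1 := by
      have := hv.1
      rwa [hvc, norm_smul, hn, Real.norm_of_nonneg hc0] at this
    rw [hvc]
    congr 1
    exact eq_inv_of_mul_eq_one_left hcr
  have hfr : pt u y (f y) ∉ interior L := by
    intro hint
    have hev : ∀ᶠ t : ℝ in nhds (f y), pt u y t ∈ L := by
      have : Continuous fun t : ℝ => pt u y t := by unfold pt; fun_prop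
      exact this.tendsto (f y) (mem_interior_iff_mem_nhds.1 hint)
    obtain ⟨t, ht, ht1⟩ := ((hev.filter_mono nhdsWithin_le_nhds).and
      (self_mem_nhdsWithin : Ioi (f y) ∈ nhdsWithin (f y) (Ioi (f y)))).exists
    exact absurd (hL.le_topFun hu ht) (not_le.2 ht1)
  obtain ⟨w, hw1, hw2⟩ := exists_unit_support hL.convex ⟨0, hL.zero_mem⟩ hfr
  have hreg : pt u y (f y) ∈ regularBoundary L :=
    ⟨⟨subset_closure hxL, hfr⟩, w, ⟨hw1, hw2⟩, fun v hv => by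
      rw [hform v hv, hform w ⟨hw1, hw2⟩]⟩
  refine ⟨hreg, fun z c => ?_⟩
  rw [hform _ (gaussMap_spec hreg), real_inner_smul_right, inner_pt_pt hu, inner_neg_right, hg]
  ring

end body

/-! ### The contribution of the upper boundary to the energy -/

/-- The integrand of the energy. -/
def energyDensity (p : ℝ) (L : Set (Euc n)) (v x : Euc n) : ENNReal :=
  ENNReal.ofReal (|⟪v, gaussMap L x⟫| ^ p * ⟪x, gaussMap L x⟫ ^ (1 - p))

/-- The regular boundary points whose normal vector points upwards with respect to `u`. -/
def upperBoundary (u : Euc n) (L : Set (Euc n)) : Set (Euc n) :=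
  {x | x ∈ regularBoundary L ∧ 0 < ⟪gaussMap L x, u⟫}

/-- The energy of a graph over an open subset of `u^⊥`. -/
def graphEnergy (p : ℝ) (f : Hyp u → ℝ) (U : Set (Hyp u)) (v' : Hyp u) (s : ℝ) : ENNReal :=
  ∫⁻ y in U, ENNReal.ofReal (|s - fderiv ℝ f y v'| ^ p * (f y - fderiv ℝ f y y) ^ (1 - p))

lemma IsBody.measurableSet_gauss {L : Set (Euc n)} (hL : IsBody L) {T : Set (Euc n)}
    (hT : MeasurableSet T) : MeasurableSet {x | x ∈ regularBoundary L ∧ gaussMap L x ∈ T} := by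
  have : {x | x ∈ regularBoundary L ∧ gaussMap L x ∈ T} =
      Subtype.val '' ((fun x : regularBoundary L => gaussMap L x) ⁻¹' T) := by
    ext x; simp [and_comm]
  rw [this]
  exact hL.measurableSet_regularBoundary.subtype_image (hL.measurable_gaussMap hT)

lemma IsBody.measurableSet_upperBoundary {L : Set (Euc n)} (hL : IsBody L) :
    MeasurableSet (upperBoundary u L) :=
  hL.measurableSet_gauss (T := {v | 0 < ⟪v, u⟫}) (measurableSet_lt (by fun_prop) (by fun_prop))

lemma aemeasurable_graph_integrand {f : Hyp u → ℝ} {U : Set (Hyp u)} (hU : IsOpen U)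
    (hf : LocallyLipschitzOn U f) (p : ℝ) (v' : Hyp u) (s : ℝ) :
    AEMeasurable (fun y => ENNReal.ofReal
      (|s - fderiv ℝ f y v'| ^ p * (f y - fderiv ℝ f y y) ^ (1 - p))) (volume.restrict U) := by
  have h1 : Measurable fun y => fderiv ℝ f y v' := measurable_fderiv_apply_const ℝ f v'
  have h2 : AEMeasurable f (volume.restrict U) := hf.continuousOn.aemeasurable hU.measurableSet
  have h3 : Measurable fun y => fderiv ℝ f y y :=
    isBoundedBilinearMap_apply.continuous.measurable.comp
      ((measurable_fderiv ℝ f).prodMk measurable_id)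
  have h4 : Measurable fun y => |s - fderiv ℝ f y v'| ^ p :=
    ((measurable_const.sub h1).norm).pow_const p
  exact (h4.aemeasurable.mul ((h2.sub h3.aemeasurable).pow_const _)).ennreal_ofReal

/-- The upper boundary contributes the energy of the graph of the upper boundary function. -/
theorem IsBody.lintegral_upperBoundary {L : Set (Euc n)} (hL : IsBody L) (hu : ‖u‖ = 1)
    (p : ℝ) (v : Euc n) :
    ∫⁻ x in upperBoundary u L, energyDensity p L v x ∂μHE[n - 1] =
      graphEnergy p (topFun u L) (interior (shadow u L)) (hproj u v) ⟪v, u⟫ := by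
  set f := topFun u L
  set U := interior (shadow u L)
  have hlip : LocallyLipschitzOn U f := hL.locallyLipschitzOn_topFun hu
  have hnull : (μHE[n - 1] : Measure (Euc n)) (graphOver u f (U \ {y | DifferentiableAt ℝ f y})) = 0 :=
    hausdorff_graph_null hu hlip sdiff_subset
      (ae_differentiableAt_of_locallyLipschitzOn isOpen_interior hlip)
  set N : Hyp u → ENNReal := fun y => ENNReal.ofReal
    (|⟪v, u⟫ - fderiv ℝ f y (hproj u v)| ^ p * (f y - fderiv ℝ f y y) ^ (1 - p)) with hN
  have hNm : AEMeasurable N (volume.restrict U) :=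
    aemeasurable_graph_integrand isOpen_interior hlip p _ _
  have hUp_sub : upperBoundary u L ⊆ graphOver u f U := by
    rintro x ⟨hx, hν⟩
    refine ⟨hproj u x, hL.hproj_mem_interior_of_pos hu hx hν.ne', ?_⟩
    simp only [f]
    rw [← hL.inner_eq_topFun_of_pos hu (hL.mem_of_regular hx) (gaussMap_spec hx) hν, pt_hproj hu]
  have hsub_Up : ∀ y ∈ U, DifferentiableAt ℝ f y → pt u y (f y) ∈ upperBoundary u L := by
    intro y hy hd
    obtain ⟨hreg, hin⟩ := hL.normal_of_differentiableAt hu hy hd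
    refine ⟨hreg, ?_⟩
    have h1 := hin 0 1
    rw [map_zero, sub_zero, mul_one] at h1
    have h2 : pt u (0 : Hyp u) 1 = u := by simp [pt]
    rw [h2, real_inner_comm] at h1
    rw [h1]; positivity
  have hcover : graphOver u f U ⊆
      upperBoundary u L ∪ graphOver u f (U \ {y | DifferentiableAt ℝ f y}) := by
    rintro _ ⟨y, hy, rfl⟩
    by_cases hd : DifferentiableAt ℝ f y
    · exact Or.inl (hsub_Up y hy hd)
    · exact Or.inr ⟨y, ⟨hy, hd⟩, rfl⟩
  have hae : (graphOver u f U : Set (Euc n)) =ᵐ[(μHE[n - 1] : Measure (Euc n))] upperBoundary u L := by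
    refine Filter.EventuallyLE.antisymm ?_ hUp_sub.eventuallyLE
    refine ae_le_set.2 (measure_mono_null ?_ hnull)
    rintro x ⟨hx, hx'⟩
    exact (hcover hx).resolve_left hx'
  have hdens : ∀ᵐ x ∂(μHE[n - 1] : Measure (Euc n)).restrict (upperBoundary u L),
      energyDensity p L v x = N (hproj u x) * (areaDensity f (hproj u x))⁻¹ := by
    rw [ae_restrict_iff' hL.measurableSet_upperBoundary]
    refine measure_mono_null (fun x hx => ?_) hnull
    rw [mem_compl_iff, Set.mem_ofPred_eq, Classical.not_imp] at hx
    obtain ⟨hxU, hx⟩ := hx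
    obtain ⟨y, hy, rfl⟩ := hUp_sub hxU
    refine ⟨y, ⟨hy, fun hd => hx ?_⟩, rfl⟩
    simp only [hproj_pt]
    obtain ⟨hreg, hin⟩ := hL.normal_of_differentiableAt hu hy hd
    have hv := hin (hproj u v) ⟪v, u⟫
    have hxx := hin y (f y)
    rw [pt_hproj hu] at hv
    have hpos := hL.inner_pos_of_normal (gaussMap_spec hreg)
    rw [hxx] at hpos
    set r := √(1 + ‖fderiv ℝ f y‖ ^ 2) with hr
    have hr0 : 0 < r := Real.sqrt_pos.2 (by positivity)
    have hpos' : 0 < f y - fderiv ℝ f y y := pos_of_mul_pos_right hpos (by positivity)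
    unfold energyDensity
    rw [hv, hxx, hN]
    simp only [areaDensity]
    rw [← hr, ← ENNReal.ofReal_inv_of_pos hr0, ← ENNReal.ofReal_mul (by positivity)]
    congr 1
    rw [abs_mul, abs_of_pos (inv_pos.2 hr0), Real.mul_rpow (by positivity) (abs_nonneg _),
      Real.mul_rpow (by positivity) hpos'.le]
    -- Degree-one homogeneity in the normal: the normalizing factors combine to the reciprocal of
    -- the area density.
    have : r⁻¹ ^ p * r⁻¹ ^ (1 - p) = r⁻¹ := by
      rw [← Real.rpow_add (by positivity)]; simp
    linear_combination (|⟪v, u⟫ - fderiv ℝ f y (hproj u v)| ^ p *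
      (f y - fderiv ℝ f y y) ^ (1 - p)) * this
  rw [lintegral_congr_ae hdens, ← Measure.restrict_congr_set hae]
  have hmap := graphMeasure_eq hu isOpen_interior hlip
  have hm : AEMeasurable (fun y => N y * (areaDensity f y)⁻¹) (graphMeasure u f U) := by
    rw [hmap]
    exact (hNm.mul (measurable_areaDensity f).inv.aemeasurable).mono_ac
      (withDensity_absolutelyContinuous _ _)
  have hmap2 := lintegral_map' hm (hproj u).continuous.measurable.aemeasurable
  rw [← hmap2]
  change ∫⁻ y, N y * (areaDensity f y)⁻¹ ∂(graphMeasure u f U) = _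
  rw [hmap]
  refine (lintegral_withDensity_eq_lintegral_mul₀ (measurable_areaDensity f).aemeasurable
    (hNm.mul (measurable_areaDensity f).inv.aemeasurable)).trans ?_
  unfold graphEnergy
  refine lintegral_congr fun y => ?_
  have h0 : areaDensity f y ≠ 0 := by
    unfold areaDensity
    exact (ENNReal.ofReal_pos.2 (Real.sqrt_pos.2 (by positivity))).ne'
  have h1 : areaDensity f y ≠ ⊤ := ENNReal.ofReal_ne_top
  simp only [Pi.mul_apply, Pi.inv_apply]
  rw [mul_left_comm, ENNReal.mul_inv_cancel h0 h1, mul_one]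

/-! ### Behaviour under linear isometries, and the decomposition of the energy -/

section isometry

variable (e : Euc n ≃ₗᵢ[ℝ] Euc n) {L : Set (Euc n)}

lemma IsBody.image_isometry (hL : IsBody L) : IsBody (e '' L) where
  convex := hL.convex.linear_image e.toLinearEquiv.toLinearMap
  compact := hL.compact.image e.continuous
  zero_mem := by
    have := e.toHomeomorph.image_interior L
    change e '' interior L = interior (e '' L) at this
    rw [← this]
    exact ⟨0, hL.zero_mem, map_zero e⟩

lemma isOuterUnitNormal_image_isometry {x v : Euc n} :
    IsOuterUnitNormal (e '' L) (e x) (e v) ↔ IsOuterUnitNormal L x v := by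
  simp [IsOuterUnitNormal]

lemma regularBoundary_image_isometry :
    regularBoundary (e '' L) = e '' regularBoundary L := by
  have hf : frontier (e '' L) = e '' frontier L := (e.toHomeomorph.image_frontier L).symm
  ext z
  obtain ⟨x, rfl⟩ := e.surjective z
  rw [e.injective.mem_set_image]
  unfold regularBoundary
  rw [Set.mem_ofPred_eq, Set.mem_ofPred_eq, hf, e.injective.mem_set_image]
  refine and_congr_right fun _ => ⟨?_, ?_⟩
  · rintro ⟨v, hv, hu⟩
    obtain ⟨w, rfl⟩ := e.surjective v
    exact ⟨w, (isOuterUnitNormal_image_isometry e).1 hv, fun w' hw' =>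
      e.injective (hu _ ((isOuterUnitNormal_image_isometry e).2 hw'))⟩
  · rintro ⟨w, hw, hu⟩
    refine ⟨e w, (isOuterUnitNormal_image_isometry e).2 hw, fun v hv => ?_⟩
    obtain ⟨w', rfl⟩ := e.surjective v
    rw [hu w' ((isOuterUnitNormal_image_isometry e).1 hv)]

lemma gaussMap_image_isometry {x : Euc n} (hx : x ∈ regularBoundary L) :
    gaussMap (e '' L) (e x) = e (gaussMap L x) :=
  gaussMap_eq (by rw [regularBoundary_image_isometry]; exact mem_image_of_mem e hx)
    ((isOuterUnitNormal_image_isometry e).2 (gaussMap_spec hx))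

lemma lintegral_energyDensity_image (p : ℝ) (v : Euc n) {S : Set (Euc n)} (hS : MeasurableSet S)
    (hSL : S ⊆ regularBoundary L) :
    ∫⁻ x in e '' S, energyDensity p (e '' L) (e v) x ∂μHE[n - 1] =
      ∫⁻ x in S, energyDensity p L v x ∂μHE[n - 1] := by
  have hmp := e.toIsometryEquiv.measurePreserving_euclideanHausdorffMeasure (n - 1)
  have h := hmp.setLIntegral_comp_emb e.toHomeomorph.measurableEmbedding
    (energyDensity p (e '' L) (e v)) S
  refine h.symm.trans (setLIntegral_congr_fun hS fun x hx => ?_)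
  change energyDensity p (e '' L) (e v) (e x) = _
  simp only [energyDensity, gaussMap_image_isometry e (hSL hx), e.inner_map_map]

theorem IsBody.energy_image_isometry (hL : IsBody L) (p : ℝ) (v : Euc n) :
    energy p (e '' L) (e v) = energy p L v := by
  have := lintegral_energyDensity_image e p v hL.measurableSet_regularBoundary Subset.rfl
  rwa [← regularBoundary_image_isometry] at this

end isometry

section reflection

/-- The reflection about `u^⊥`. -/
def refl (u : Euc n) : Euc n ≃ₗᵢ[ℝ] Euc n := (Hyp u).reflection

variable {L : Set (Euc n)}

lemma reflectBody_eq : reflectBody u L = refl u '' L := rfl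

lemma refl_refl (x : Euc n) : refl u (refl u x) = x := Submodule.reflection_reflection _ x

lemma refl_pt (y : Hyp u) (s : ℝ) : refl u (pt u y s) = pt u y (-s) := by
  have h1 : refl u (y : Euc n) = y := Submodule.reflection_mem_subspace_eq_self y.2
  have h2 : refl u u = -u :=
    Submodule.reflection_mem_subspace_orthogonal_precomplement_eq_neg
      (Submodule.mem_span_singleton_self u)
  rw [pt, map_add, map_smul, h1, h2, pt, smul_neg, neg_smul]

lemma hproj_refl (hu : ‖u‖ = 1) (x : Euc n) : hproj u (refl u x) = hproj u x := by
  conv_lhs => rw [← pt_hproj hu x, refl_pt, hproj_pt]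

lemma inner_refl (hu : ‖u‖ = 1) (x : Euc n) : ⟪refl u x, u⟫ = -⟪x, u⟫ := by
  conv_lhs => rw [← pt_hproj hu x, refl_pt, inner_pt_u hu]

lemma pt_mem_reflectBody {y : Hyp u} {s : ℝ} : pt u y s ∈ reflectBody u L ↔ pt u y (-s) ∈ L := by
  rw [reflectBody_eq, ← refl_refl (pt u y s), (refl u).injective.mem_set_image, refl_pt]

lemma reflectBody_reflectBody : reflectBody u (reflectBody u L) = L := by
  rw [reflectBody_eq, reflectBody_eq, image_image]
  simp [refl_refl]

lemma shadow_reflectBody (hu : ‖u‖ = 1) : shadow u (reflectBody u L) = shadow u L := by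
  rw [shadow, reflectBody_eq, image_image]
  simp only [hproj_refl hu]
  rfl

lemma IsBody.reflectBody (hL : IsBody L) : IsBody (reflectBody u L) := hL.image_isometry _

lemma IsBody.energy_reflectBody (hL : IsBody L) (p : ℝ) (v : Euc n) :
    energy p (LpProjection.reflectBody u L) v = energy p L (refl u v) := by
  have := hL.energy_image_isometry (refl u) p (refl u v)
  rwa [refl_refl] at this

/-- The regular boundary points whose normal vector points downwards with respect to `u`. -/
def lowerBoundary (u : Euc n) (L : Set (Euc n)) : Set (Euc n) :=
  {x | x ∈ regularBoundary L ∧ ⟪gaussMap L x, u⟫ < 0}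

/-- The regular boundary points whose normal vector is orthogonal to `u`. -/
def lateralBoundary (u : Euc n) (L : Set (Euc n)) : Set (Euc n) :=
  {x | x ∈ regularBoundary L ∧ ⟪gaussMap L x, u⟫ = 0}

lemma IsBody.measurableSet_lowerBoundary (hL : IsBody L) : MeasurableSet (lowerBoundary u L) :=
  hL.measurableSet_gauss (T := {v | ⟪v, u⟫ < 0}) (measurableSet_lt (by fun_prop) (by fun_prop))

lemma IsBody.measurableSet_lateralBoundary (hL : IsBody L) : MeasurableSet (lateralBoundary u L) :=
  hL.measurableSet_gauss (T := {v | ⟪v, u⟫ = 0})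
    (measurableSet_eq_fun (by fun_prop) (by fun_prop))

lemma upperBoundary_reflectBody (hu : ‖u‖ = 1) :
    upperBoundary u (reflectBody u L) = refl u '' lowerBoundary u L := by
  ext z
  obtain ⟨x, rfl⟩ := (refl u).surjective z
  rw [(refl u).injective.mem_set_image]
  simp only [upperBoundary, lowerBoundary, Set.mem_ofPred_eq, reflectBody_eq,
    regularBoundary_image_isometry, (refl u).injective.mem_set_image]
  refine and_congr_right fun hx => ?_
  rw [gaussMap_image_isometry _ hx, inner_refl hu, Left.neg_pos_iff]

/-- The reflection turns the lower boundary of `L` into the upper boundary of `R_u L` and `⟨v, u⟩`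
into its negative, so one graph formula serves both sides. -/
theorem IsBody.energy_eq (hL : IsBody L) (hu : ‖u‖ = 1) (p : ℝ) (v : Euc n) :
    energy p L v = graphEnergy p (topFun u L) (interior (shadow u L)) (hproj u v) ⟪v, u⟫ +
      graphEnergy p (topFun u (LpProjection.reflectBody u L)) (interior (shadow u L)) (hproj u v)
        (-⟪v, u⟫) +
      ∫⁻ x in lateralBoundary u L, energyDensity p L v x ∂μHE[n - 1] := by
  have h1 := hL.lintegral_upperBoundary hu p v
  have h2 := (hL.reflectBody (u := u)).lintegral_upperBoundary hu p (refl u v)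
  rw [upperBoundary_reflectBody hu, shadow_reflectBody hu, hproj_refl hu, inner_refl hu,
    reflectBody_eq, lintegral_energyDensity_image _ p v hL.measurableSet_lowerBoundary
      (fun x hx => hx.1), ← reflectBody_eq] at h2
  rw [← h1, ← h2, ← lintegral_union hL.measurableSet_lowerBoundary,
    ← lintegral_union hL.measurableSet_lateralBoundary]
  · unfold energy
    congr 2
    ext x
    simp only [upperBoundary, lowerBoundary, lateralBoundary, mem_union, Set.mem_ofPred_eq,
      ← and_or_left]
    refine (and_iff_left ?_).symm
    rcases lt_trichotomy ⟪gaussMap L x, u⟫ 0 with h | h | h <;> simp [h]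
  · refine disjoint_left.2 fun x hx hx' => ?_
    rcases hx with hx | hx
    · exact hx.2.ne' hx'.2
    · exact hx.2.ne hx'.2
  · exact disjoint_left.2 fun x hx hx' => lt_asymm hx.2 hx'.2

end reflection

/-! ### The surface measure on cylinders -/

/-- The surface measure of the cylinder `∂P + ℝu` in the coordinates of `u^⊥ × ℝ`. -/
def cylinderMeasure (hu : ‖u‖ = 1) (P : Set (Hyp u)) : Measure (Hyp u × ℝ) :=
  ((μHE[n - 1] : Measure (Euc n)).restrict (hproj u ⁻¹' frontier P)).map (ptEquiv hu).symm

lemma cylinderMeasure_apply (hu : ‖u‖ = 1) (P : Set (Hyp u)) {S : Set (Hyp u × ℝ)}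
    (hS : MeasurableSet S) : cylinderMeasure hu P S =
      (μHE[n - 1] : Measure (Euc n)) {x | (hproj u x, ⟪x, u⟫) ∈ S ∧ hproj u x ∈ frontier P} := by
  have hm : Measurable (ptEquiv hu).symm := (ptEquiv hu).symm.continuous.measurable
  rw [cylinderMeasure, Measure.map_apply hm hS, Measure.restrict_apply (hm hS)]
  rfl

lemma IsBody.cylinder {L : Set (Euc n)} (hL : IsBody L) (hu : ‖u‖ = 1) {R : ℝ}
    (hR : ∀ x ∈ L, ‖x‖ ≤ R) : IsBody {x : Euc n | hproj u x ∈ shadow u L ∧ |⟪x, u⟫| ≤ R} where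
  convex := by
    intro x hx y hy a b ha hb hab
    refine ⟨?_, ?_⟩
    · rw [map_add, map_smul, map_smul]
      exact hL.convex_shadow hx.1 hy.1 ha hb hab
    · rw [inner_add_left, real_inner_smul_left, real_inner_smul_left]
      refine (abs_add_le _ _).trans ?_
      rw [abs_mul, abs_mul, abs_of_nonneg ha, abs_of_nonneg hb]
      have h1 := mul_le_mul_of_nonneg_left hx.2 ha
      have h2 := mul_le_mul_of_nonneg_left hy.2 hb
      have h3 : a * R + b * R = R := by rw [← add_mul, hab, one_mul]
      linarith
  compact := by
    have : {x : Euc n | hproj u x ∈ shadow u L ∧ |⟪x, u⟫| ≤ R} =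
        ptEquiv hu '' (shadow u L ×ˢ Icc (-R) R) := by
      ext x
      constructor
      · rintro ⟨h1, h2⟩
        exact ⟨(hproj u x, ⟪x, u⟫), ⟨h1, abs_le.1 h2⟩, pt_hproj hu x⟩
      · rintro ⟨⟨y, s⟩, ⟨h1, h2⟩, rfl⟩
        refine ⟨?_, ?_⟩
        · change hproj u (pt u y s) ∈ _
          rwa [hproj_pt]
        · change |⟪pt u y s, u⟫| ≤ _
          rw [inner_pt_u hu]; exact abs_le.2 h2
    rw [this]
    exact (hL.isCompact_shadow.prod isCompact_Icc).image (ptEquiv hu).continuous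
  zero_mem := by
    have hsub : L ⊆ {x : Euc n | hproj u x ∈ shadow u L ∧ |⟪x, u⟫| ≤ R} := by
      intro x hx
      have := abs_real_inner_le_norm x u
      rw [hu, mul_one] at this
      exact ⟨hproj_mem_shadow hx, this.trans (hR x hx)⟩
    exact interior_mono hsub hL.zero_mem

/-- The truncated lateral surface lies in the boundary of a truncated solid cylinder. Making the
latter tall enough to contain `L` makes it a body with the origin inside, of finite surface area. -/
lemma IsBody.cylinderMeasure_lt_top {L : Set (Euc n)} (hL : IsBody L) (hu : ‖u‖ = 1) (hn : 0 < n)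
    (R : ℝ) : cylinderMeasure hu (shadow u L) (univ ×ˢ Icc (-R) R) < ⊤ := by
  obtain ⟨R₀, hR₀⟩ := hL.compact.isBounded.exists_norm_le
  have hbody := hL.cylinder hu (R := max R R₀) fun x hx => (hR₀ x hx).trans (le_max_right _ _)
  rw [cylinderMeasure_apply hu _ (MeasurableSet.univ.prod measurableSet_Icc)]
  refine (measure_mono ?_).trans_lt (hbody.hausdorff_frontier_lt_top hn)
  rintro x ⟨⟨-, hx⟩, hxP⟩
  refine ⟨subset_closure ⟨hL.isCompact_shadow.isClosed.frontier_subset hxP,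
    (abs_le.2 hx).trans (le_max_left _ _)⟩, fun hint => hxP.2 ?_⟩
  have hcont : Continuous fun y : Hyp u => pt u y ⟪x, u⟫ := by unfold pt; fun_prop
  refine mem_interior_iff_mem_nhds.2 ?_
  have h1 := mem_interior_iff_mem_nhds.1 hint
  rw [← pt_hproj hu x] at h1
  have h2 := hcont.continuousAt.preimage_mem_nhds h1
  refine Filter.mem_of_superset h2 fun y hy => ?_
  have := hy.1
  rwa [hproj_pt] at this

/-- Translations along `u` preserve both the cylinder and `ℋ^{n-1}`. For fixed `A`, the measure `B ↦
Z(A × B)` is thus translation invariant and locally finite on `ℝ`, hence a multiple of Lebesgue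
measure. The base measure `σ` need not be identified. -/
lemma IsBody.exists_cylinderMeasure_eq_prod {L : Set (Euc n)} (hL : IsBody L) (hu : ‖u‖ = 1)
    (hn : 0 < n) : ∃ σ : Measure (Hyp u), IsFiniteMeasure σ ∧
      cylinderMeasure hu (shadow u L) = σ.prod volume := by
  set Z := cylinderMeasure hu (shadow u L) with hZ
  have key : ∀ A : Set (Hyp u), MeasurableSet A → ∀ B : Set ℝ, MeasurableSet B →
      Z (A ×ˢ B) = Z (A ×ˢ Icc 0 1) * volume B := by
    intro A hA
    let m : Measure ℝ := (Z.restrict (A ×ˢ univ)).map Prod.snd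
    have hm : ∀ B, MeasurableSet B → m B = Z (A ×ˢ B) := by
      intro B hB
      rw [Measure.map_apply measurable_snd hB, Measure.restrict_apply (measurable_snd hB)]
      congr 1
      ext ⟨y, s⟩
      simp [and_comm]
    have hinv : m.IsAddLeftInvariant := by
      refine ⟨fun c => Measure.ext fun B hB => ?_⟩
      have hB' : MeasurableSet ((fun s => c + s) ⁻¹' B) := (measurable_const_add c) hB
      rw [Measure.map_apply (measurable_const_add c) hB, hm _ hB', hm _ hB, hZ,
        cylinderMeasure_apply hu _ (hA.prod hB'), cylinderMeasure_apply hu _ (hA.prod hB)]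
      refine Eq.trans ?_ (measure_preimage_add (μHE[n - 1] : Measure (Euc n)) (c • u) _)
      congr 1
      ext x
      have h1 : hproj u (c • u + x) = hproj u x := by
        rw [map_add, map_smul, hproj_u, smul_zero, zero_add]
      have h2 : ⟪c • u + x, u⟫ = c + ⟪x, u⟫ := by
        simp [inner_add_left, real_inner_smul_left, hu]
      simp only [mem_preimage, Set.mem_ofPred_eq, mem_prod, h1, h2]
    have hfin : IsFiniteMeasureOnCompacts m := by
      refine ⟨fun K hK => ?_⟩
      obtain ⟨R, hR⟩ := hK.isBounded.exists_norm_le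
      have hsub : K ⊆ Icc (-R) R := fun s hs => abs_le.1 (hR s hs)
      refine (measure_mono hsub).trans_lt ?_
      rw [hm _ measurableSet_Icc]
      exact (measure_mono (prod_mono_left (subset_univ _))).trans_lt
        (hL.cylinderMeasure_lt_top hu hn R)
    obtain ⟨c, hc⟩ : ∃ c : NNReal, m = c • volume := ⟨_, Measure.isAddLeftInvariant_eq_smul m volume⟩
    intro B hB
    rw [← hm _ hB, ← hm _ measurableSet_Icc, hc, Measure.smul_apply, Measure.smul_apply,
      Real.volume_Icc, sub_zero, ENNReal.ofReal_one, smul_mul_assoc, one_mul]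
  refine ⟨(Z.restrict (univ ×ˢ Icc 0 1)).map Prod.fst, ?_, ?_⟩
  · have h1 : IsFiniteMeasure (Z.restrict (univ ×ˢ Icc (0 : ℝ) 1)) := by
      refine isFiniteMeasure_restrict.2 (ne_top_of_le_ne_top
        (hL.cylinderMeasure_lt_top hu hn 1).ne (measure_mono ?_))
      exact prod_mono_right (Icc_subset_Icc (by norm_num) le_rfl)
    infer_instance
  · have h1 : IsFiniteMeasure (Z.restrict (univ ×ˢ Icc (0 : ℝ) 1)) := by
      refine isFiniteMeasure_restrict.2 (ne_top_of_le_ne_top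
        (hL.cylinderMeasure_lt_top hu hn 1).ne (measure_mono ?_))
      exact prod_mono_right (Icc_subset_Icc (by norm_num) le_rfl)
    refine (Measure.prod_eq fun A B hA hB => ?_).symm
    rw [key A hA B hB, Measure.map_apply measurable_fst hA,
      Measure.restrict_apply (measurable_fst hA)]
    congr 2
    ext ⟨y, s⟩
    simp

/-! ### The lateral boundary -/

/-- `w` is the only unit outer normal vector of `P ⊆ u^⊥` at `y`. -/
def IsUniqueNormal (P : Set (Hyp u)) (y w : Hyp u) : Prop :=
  ‖w‖ = 1 ∧ (∀ z ∈ P, ⟪z, w⟫ ≤ ⟪y, w⟫) ∧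
    ∀ w' : Hyp u, ‖w'‖ = 1 → (∀ z ∈ P, ⟪z, w'⟫ ≤ ⟪y, w'⟫) → w' = w

section lateral

variable {L : Set (Euc n)}

lemma coe_hproj_of_inner_eq_zero (hu : ‖u‖ = 1) {v : Euc n} (hv : ⟪v, u⟫ = 0) :
    (hproj u v : Euc n) = v := by
  have := pt_hproj hu v
  rwa [hv, pt, zero_smul, add_zero] at this

lemma isUniqueNormal_of_lateral (hu : ‖u‖ = 1) {y : Hyp u} {s : ℝ}
    (h : pt u y s ∈ lateralBoundary u L) :
    IsUniqueNormal (shadow u L) y (hproj u (gaussMap L (pt u y s))) := by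
  obtain ⟨hreg, h0⟩ := h
  have hspec := gaussMap_spec hreg
  have hc := coe_hproj_of_inner_eq_zero hu h0
  have hn : ‖hproj u (gaussMap L (pt u y s))‖ = 1 := by
    rw [← hspec.1, ← hc]; simp [hc]
  refine ⟨hn, ?_, fun w' hw' hP => ?_⟩
  · rw [← hc] at hspec
    exact (isOuterUnitNormal_hyp hn).1 hspec
  · have := gaussMap_eq hreg ((isOuterUnitNormal_hyp hw').2 hP)
    rw [← hc] at this
    exact (Subtype.ext this).symm

/-- At an interior height one can move both up and down inside `L`, which forces every normal to be
horizontal, hence a normal of the shadow. At the ends of the section `L` may have other normals. -/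
lemma lateral_of_isUniqueNormal (hu : ‖u‖ = 1) {y w : Hyp u} {s : ℝ}
    (hw : IsUniqueNormal (shadow u L) y w) (hs : s ∈ interior (lineSection L u y)) :
    pt u y s ∈ lateralBoundary u L ∧ gaussMap L (pt u y s) = w := by
  have hsL : s ∈ lineSection L u y := interior_subset hs
  rw [mem_lineSection] at hsL
  have hnorm : IsOuterUnitNormal L (pt u y s) (w : Euc n) := (isOuterUnitNormal_hyp hw.1).2 hw.2.1
  have huniq : ∀ v, IsOuterUnitNormal L (pt u y s) v → v = w := by
    intro v hv
    obtain ⟨r, hr, hball⟩ := Metric.nhds_basis_closedBall.mem_iff.1 (mem_interior_iff_mem_nhds.1 hs)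
    have h1 : pt u y (s + r) ∈ L := hball (by simp [abs_of_pos hr])
    have h2 : pt u y (s - r) ∈ L := hball (by simp [abs_of_pos hr])
    have h3 := hv.2 _ h1
    have h4 := hv.2 _ h2
    have hv0 : ⟪v, u⟫ = 0 := by
      simp only [pt, inner_add_left, real_inner_smul_left, real_inner_comm v u] at h3 h4
      nlinarith
    have hc := coe_hproj_of_inner_eq_zero hu hv0
    have hn : ‖hproj u v‖ = 1 := by rw [← hv.1, ← hc]; simp [hc]
    rw [← hc] at hv
    rw [← hc, hw.2.2 _ hn ((isOuterUnitNormal_hyp hn).1 hv)]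
  have hreg : pt u y s ∈ regularBoundary L :=
    ⟨IsBody.mem_frontier_of_normal hsL hnorm, w, hnorm, huniq⟩
  have hg := gaussMap_eq hreg hnorm
  exact ⟨⟨hreg, by rw [hg]; exact inner_hyp_left w⟩, hg⟩

lemma IsBody.measurable_indicator_energyDensity (hL : IsBody L) (p : ℝ) (v : Euc n) :
    Measurable ((lateralBoundary u L).indicator (energyDensity p L v)) := by
  let g : Euc n → Euc n := (regularBoundary L).indicator (gaussMap L)
  have hg : Measurable g := by
    refine measurable_of_restrict_of_restrict_compl hL.measurableSet_regularBoundary ?_ ?_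
    · have : (regularBoundary L).domRestrict g = fun x : regularBoundary L => gaussMap L x := by
        ext1 x; exact indicator_of_mem x.2 _
      rw [this]; exact hL.measurable_gaussMap
    · have : (regularBoundary L)ᶜ.domRestrict g = fun _ => 0 := by
        ext1 x; exact indicator_of_notMem x.2 _
      rw [this]; exact measurable_const
  have : (lateralBoundary u L).indicator (energyDensity p L v) =
      (lateralBoundary u L).indicator
        (fun x => ENNReal.ofReal (|⟪v, g x⟫| ^ p * ⟪x, g x⟫ ^ (1 - p))) := by
    refine indicator_congr fun x hx => ?_
    have : g x = gaussMap L x := indicator_of_mem hx.1 _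
    rw [this]; rfl
  rw [this]
  refine Measurable.indicator ?_ hL.measurableSet_lateralBoundary
  have h0 : Measurable fun x => ⟪v, g x⟫ := measurable_const.inner hg
  have h1 : Measurable fun x => |⟪v, g x⟫| := h0.norm
  have h2 : Measurable fun x => ⟪x, g x⟫ := measurable_id.inner hg
  exact ((h1.pow_const p).mul (h2.pow_const _)).ennreal_ofReal

/-- Along the fibre the normal is constantly `w`, and so is the integrand, except at the ends of the
section, which are null. -/
lemma IsBody.lintegral_fiber_of_isUniqueNormal (hL : IsBody L) (hu : ‖u‖ = 1) (p : ℝ) (v : Euc n)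
    {y w : Hyp u} (hw : IsUniqueNormal (shadow u L) y w) :
    ∫⁻ s, (lateralBoundary u L).indicator (energyDensity p L v) (pt u y s) =
      ENNReal.ofReal (|⟪hproj u v, w⟫| ^ p * ⟪y, w⟫ ^ (1 - p)) * volume (lineSection L u y) := by
  have hin : ∀ x : Euc n, ⟪x, (w : Euc n)⟫ = ⟪hproj u x, w⟫ := fun x => by
    rw [real_inner_comm, ← inner_hproj hu, real_inner_comm]
  rw [← lintegral_indicator_const (hL.isCompact_lineSection hu y).isClosed.measurableSet]
  refine lintegral_congr_ae ?_
  have hfr : ∀ᵐ s, s ∉ frontier (lineSection L u y) :=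
    measure_eq_zero_iff_ae_notMem.1 ((hL.convex_lineSection y).addHaar_frontier volume)
  filter_upwards [hfr] with s hs
  by_cases hsL : s ∈ lineSection L u y
  · have hint : s ∈ interior (lineSection L u y) := by
      by_contra hcon
      exact hs ⟨subset_closure hsL, hcon⟩
    obtain ⟨h1, h2⟩ := lateral_of_isUniqueNormal hu hw hint
    rw [indicator_of_mem h1, indicator_of_mem hsL, energyDensity, h2, hin, hin, hproj_pt]
  · rw [indicator_of_notMem hsL, indicator_of_notMem]
    exact fun hcon => hsL (hL.mem_of_regular hcon.1)

lemma IsBody.lateral_subset_cylinder (hL : IsBody L) (hu : ‖u‖ = 1) :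
    lateralBoundary u L ⊆ hproj u ⁻¹' frontier (shadow u L) := by
  intro x hx
  have hx' := hx
  rw [← pt_hproj hu x] at hx'
  obtain ⟨h1, h2, -⟩ := isUniqueNormal_of_lateral hu hx'
  set w := hproj u (gaussMap L (pt u (hproj u x) ⟪x, u⟫))
  refine ⟨subset_closure (hproj_mem_shadow (hL.mem_of_regular hx.1)), fun hint => ?_⟩
  obtain ⟨r, hr, hball⟩ := Metric.nhds_basis_closedBall.mem_iff.1 (mem_interior_iff_mem_nhds.1 hint)
  have h3 : hproj u x + r • w ∈ shadow u L := hball (by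
    rw [mem_closedBall_iff_norm, add_sub_cancel_left, norm_smul, h1, mul_one,
      Real.norm_of_nonneg hr.le])
  have := h2 _ h3
  rw [inner_add_left, real_inner_smul_left, real_inner_self_eq_norm_sq, h1] at this
  linarith

lemma IsBody.lintegral_lateral_eq_cylinder (hL : IsBody L) (hu : ‖u‖ = 1) (p : ℝ) (v : Euc n) :
    ∫⁻ x in lateralBoundary u L, energyDensity p L v x ∂μHE[n - 1] =
      ∫⁻ q, (lateralBoundary u L).indicator (energyDensity p L v) (pt u q.1 q.2)
        ∂(cylinderMeasure hu (shadow u L)) := by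
  have hm := hL.measurable_indicator_energyDensity (u := u) p v
  rw [cylinderMeasure]
  refine Eq.trans ?_ (lintegral_map (hm.comp continuous_pt.measurable)
    (ptEquiv hu).symm.continuous.measurable).symm
  have h1 : ∀ x : Euc n, pt u ((ptEquiv hu).symm x).1 ((ptEquiv hu).symm x).2 = x :=
    fun x => pt_hproj hu x
  simp only [Function.comp_apply, h1]
  rw [lintegral_indicator hL.measurableSet_lateralBoundary, Measure.restrict_restrict
    hL.measurableSet_lateralBoundary, inter_eq_left.2 (hL.lateral_subset_cylinder hu)]

/-- The lateral contribution to the energy of `v` depends only on the projection of the body, on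
the lengths of its sections parallel to `u`, and on the projection of `v`. -/
theorem IsBody.lintegral_lateral_congr {M : Set (Euc n)} (hL : IsBody L) (hM : IsBody M)
    (hn : 0 < n) (hu : ‖u‖ = 1) (hP : shadow u M = shadow u L)
    (hlen : ∀ y : Hyp u, volume (lineSection M u y) = volume (lineSection L u y)) (p : ℝ)
    {v v' : Euc n} (hv : hproj u v' = hproj u v) :
    ∫⁻ x in lateralBoundary u M, energyDensity p M v' x ∂μHE[n - 1] =
      ∫⁻ x in lateralBoundary u L, energyDensity p L v x ∂μHE[n - 1] := by
  rw [hL.lintegral_lateral_eq_cylinder hu, hM.lintegral_lateral_eq_cylinder hu, hP]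
  obtain ⟨σ, hσ, hprod⟩ := hL.exists_cylinderMeasure_eq_prod hu hn
  have hmL := (hL.measurable_indicator_energyDensity (u := u) p v).comp (continuous_pt (u := u)).measurable
  have hmM := (hM.measurable_indicator_energyDensity (u := u) p v').comp (continuous_pt (u := u)).measurable
  rw [hprod]
  refine (lintegral_prod _ hmM.aemeasurable).trans
    ((lintegral_congr fun y => ?_).trans (lintegral_prod _ hmL.aemeasurable).symm)
  simp only [Function.comp_apply]
  by_cases hw : ∃ w, IsUniqueNormal (shadow u L) y w
  · obtain ⟨w, hw⟩ := hw
    rw [hL.lintegral_fiber_of_isUniqueNormal hu p v hw,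
      hM.lintegral_fiber_of_isUniqueNormal hu p v' (hP ▸ hw), hlen, hv]
  · have h1 : ∀ s, pt u y s ∉ lateralBoundary u L := fun s hs =>
      hw ⟨_, isUniqueNormal_of_lateral hu hs⟩
    have h2 : ∀ s, pt u y s ∉ lateralBoundary u M := fun s hs =>
      hw ⟨_, hP ▸ isUniqueNormal_of_lateral hu hs⟩
    simp [h1, h2]

end lateral

/-! ### Reflection shadow systems -/

section shadowSystem

variable {L : Set (Euc n)}

lemma pt_mem_reflectionShadow (hu : ‖u‖ = 1) {t : ℝ} {y : Hyp u} {s : ℝ} :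
    pt u y s ∈ reflectionShadow L u t ↔
      ∃ a b, pt u y a ∈ L ∧ pt u y b ∈ L ∧ s = (1 + t) / 2 * a - (1 - t) / 2 * b := by
  constructor
  · rintro ⟨y', hy', s', hs', hx⟩
    obtain ⟨rfl, rfl⟩ := pt_injective (z := ⟨y', hy'⟩) (t := s') hu hx
    obtain ⟨_, ⟨a, ha, rfl⟩, _, ⟨b, hb, rfl⟩, hab⟩ := hs'
    refine ⟨a, -b, ha, ?_, ?_⟩
    · exact pt_mem_reflectBody.1 hb
    · rw [← hab]; simp only [smul_eq_mul]; ring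
  · rintro ⟨a, b, ha, hb, rfl⟩
    refine ⟨y, y.2, _, ⟨_, ⟨a, ha, rfl⟩, _, ⟨-b, ?_, rfl⟩, rfl⟩, ?_⟩
    · rw [mem_lineSection, pt_mem_reflectBody, neg_neg]; exact hb
    · simp only [pt, smul_eq_mul]; congr 2; ring

lemma ext_pt (hu : ‖u‖ = 1) {A B : Set (Euc n)}
    (h : ∀ (y : Hyp u) (s : ℝ), pt u y s ∈ A ↔ pt u y s ∈ B) : A = B := by
  ext x
  rw [← pt_hproj hu x]
  exact h _ _

lemma reflectBody_reflectionShadow (hu : ‖u‖ = 1) (t : ℝ) :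
    reflectBody u (reflectionShadow L u t) = reflectionShadow L u (-t) := by
  refine ext_pt hu fun y s => ?_
  rw [pt_mem_reflectBody, pt_mem_reflectionShadow hu, pt_mem_reflectionShadow hu]
  constructor
  · rintro ⟨a, b, ha, hb, h⟩
    exact ⟨b, a, hb, ha, by linear_combination -h⟩
  · rintro ⟨a, b, ha, hb, h⟩
    exact ⟨b, a, hb, ha, by linear_combination -h⟩

lemma reflectBody_reflectionShadow' (hu : ‖u‖ = 1) (t : ℝ) :
    reflectBody u (reflectionShadow L u t) = reflectionShadow (reflectBody u L) u t := by
  refine ext_pt hu fun y s => ?_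
  simp only [pt_mem_reflectBody, pt_mem_reflectionShadow hu]
  constructor
  · rintro ⟨a, b, ha, hb, h⟩
    exact ⟨-a, -b, by rwa [neg_neg], by rwa [neg_neg], by linear_combination -h⟩
  · rintro ⟨a, b, ha, hb, h⟩
    exact ⟨-a, -b, ha, hb, by linear_combination -h⟩

lemma reflectionShadow_one (hu : ‖u‖ = 1) : reflectionShadow L u 1 = L := by
  refine ext_pt hu fun y s => ?_
  rw [pt_mem_reflectionShadow hu]
  constructor
  · rintro ⟨a, b, ha, hb, rfl⟩
    convert ha using 2; ring
  · exact fun h => ⟨s, s, h, h, by ring⟩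

lemma IsBody.exists_combination (hL : IsBody L) {y : Hyp u} {a b c d : ℝ} (ha : pt u y a ∈ L)
    (hb : pt u y b ∈ L) (hc : 0 ≤ c) (hd : 0 ≤ d) :
    ∃ e, pt u y e ∈ L ∧ c * a + d * b = (c + d) * e := by
  rcases (add_nonneg hc hd).eq_or_lt with h | h
  · refine ⟨a, ha, ?_⟩
    have h1 : c = 0 := by linarith
    have h2 : d = 0 := by linarith
    simp [h1, h2]
  · refine ⟨_, hL.convex_lineSection y ha hb (div_nonneg hc h.le) (div_nonneg hd h.le)
      (by rw [← add_div, div_self h.ne']), ?_⟩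
    simp only [smul_eq_mul]
    field_simp

lemma IsBody.reflectionShadow_reflectionShadow (hL : IsBody L) (hu : ‖u‖ = 1) {t τ : ℝ}
    (ht : t ∈ Icc (-1 : ℝ) 1) (hτ : τ ∈ Icc (-1 : ℝ) 1) :
    reflectionShadow (reflectionShadow L u t) u τ = reflectionShadow L u (t * τ) := by
  refine ext_pt hu fun y s => ?_
  simp only [pt_mem_reflectionShadow hu]
  constructor
  · rintro ⟨_, _, ⟨a, b, ha, hb, rfl⟩, ⟨a', b', ha', hb', rfl⟩, rfl⟩
    obtain ⟨h1, h2⟩ := ht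
    obtain ⟨h3, h4⟩ := hτ
    -- Of the four heights, `a` and `b'` enter with a plus sign and total weight `(1 + tτ)/2`, while
    -- `b` and `a'` enter with a minus sign and total weight `(1 - tτ)/2`; convexity merges each
    -- pair into one height.
    obtain ⟨c, hc, hc'⟩ := hL.exists_combination (c := (1 + τ) / 2 * ((1 + t) / 2))
      (d := (1 - τ) / 2 * ((1 - t) / 2)) ha hb'
      (mul_nonneg (by linarith) (by linarith)) (mul_nonneg (by linarith) (by linarith))
    obtain ⟨d, hd, hd'⟩ := hL.exists_combination (c := (1 + τ) / 2 * ((1 - t) / 2))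
      (d := (1 - τ) / 2 * ((1 + t) / 2)) hb ha'
      (mul_nonneg (by linarith) (by linarith)) (mul_nonneg (by linarith) (by linarith))
    exact ⟨c, d, hc, hd, by linear_combination hc' - hd'⟩
  · rintro ⟨a, b, ha, hb, rfl⟩
    exact ⟨_, _, ⟨a, b, ha, hb, rfl⟩, ⟨b, a, hb, ha, rfl⟩, by ring⟩

theorem IsBody.reflectionShadow (hL : IsBody L) (hu : ‖u‖ = 1) (t : ℝ) :
    IsBody (reflectionShadow L u t) where
  convex := by
    intro x hx x' hx' c d hc hd hcd
    rw [← pt_hproj hu x] at hx ⊢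
    rw [← pt_hproj hu x'] at hx' ⊢
    obtain ⟨a, b, ha, hb, h⟩ := (pt_mem_reflectionShadow hu).1 hx
    obtain ⟨a', b', ha', hb', h'⟩ := (pt_mem_reflectionShadow hu).1 hx'
    rw [pt_smul, pt_smul, pt_add, pt_mem_reflectionShadow hu]
    have h1 := hL.convex ha ha' hc hd hcd
    have h2 := hL.convex hb hb' hc hd hcd
    rw [pt_smul, pt_smul, pt_add] at h1 h2
    exact ⟨_, _, h1, h2, by rw [h, h']; ring⟩
  compact := by
    have : LpProjection.reflectionShadow L u t =
        (fun q : Euc n × Euc n =>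
          pt u (hproj u q.1) ((1 + t) / 2 * ⟪q.1, u⟫ - (1 - t) / 2 * ⟪q.2, u⟫)) ''
        ((L ×ˢ L) ∩ {q | hproj u q.1 = hproj u q.2}) := by
      refine ext_pt hu fun y s => ?_
      rw [pt_mem_reflectionShadow hu]
      constructor
      · rintro ⟨a, b, ha, hb, rfl⟩
        refine ⟨(pt u y a, pt u y b), ⟨⟨ha, hb⟩, ?_⟩, ?_⟩
        · simp [hproj_pt]
        · simp only [hproj_pt, inner_pt_u hu]
      · rintro ⟨⟨x, x'⟩, ⟨⟨hx, hx'⟩, h⟩, h'⟩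
        obtain ⟨h1, h2⟩ := pt_injective hu h'
        simp only [Set.mem_ofPred_eq] at h h1 h2
        refine ⟨⟪x, u⟫, ⟪x', u⟫, ?_, ?_, h2.symm⟩
        · rwa [← h1, pt_hproj hu]
        · rwa [← h1, h, pt_hproj hu]
    rw [this]
    refine IsCompact.image ?_ ?_
    · exact (hL.compact.prod hL.compact).inter_right (isClosed_eq (by fun_prop) (by fun_prop))
    · exact continuous_pt.comp (f := fun q : Euc n × Euc n => (hproj u q.1,
        (1 + t) / 2 * ⟪q.1, u⟫ - (1 - t) / 2 * ⟪q.2, u⟫)) (by fun_prop)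
  zero_mem := by
    obtain ⟨r, hr, h⟩ := hL.exists_closedBall_subset
    refine mem_interior_iff_mem_nhds.2 (Filter.mem_of_superset (Metric.closedBall_mem_nhds _ hr) ?_)
    intro x hx
    rw [← pt_hproj hu x, pt_mem_reflectionShadow hu]
    -- A ball about the origin is symmetric under the reflection, so a ball contained in `L` stays
    -- in every `L_t`.
    refine ⟨⟪x, u⟫, -⟪x, u⟫, ?_, ?_, by ring⟩
    · rw [pt_hproj hu]; exact h hx
    · rw [← refl_pt, pt_hproj hu]
      exact h (by simpa using hx)

lemma shadow_reflectionShadow (hu : ‖u‖ = 1) (t : ℝ) :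
    shadow u (reflectionShadow L u t) = shadow u L := by
  ext y
  constructor
  · intro hy
    obtain ⟨s, hs⟩ := exists_pt_of_mem_shadow hu hy
    obtain ⟨a, b, ha, -, -⟩ := (pt_mem_reflectionShadow hu).1 hs
    exact mem_shadow_of_pt ha
  · intro hy
    obtain ⟨s, hs⟩ := exists_pt_of_mem_shadow hu hy
    exact mem_shadow_of_pt ((pt_mem_reflectionShadow hu).2 ⟨s, s, hs, hs, rfl⟩)

lemma IsBody.neg_topFun_reflect_mem (hL : IsBody L) (hu : ‖u‖ = 1) {y : Hyp u}
    (hy : y ∈ shadow u L) : pt u y (-topFun u (LpProjection.reflectBody u L) y) ∈ L :=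
  pt_mem_reflectBody.1 ((hL.reflectBody (u := u)).pt_topFun_mem hu
    (by rwa [shadow_reflectBody hu]))

lemma IsBody.neg_le_topFun_reflect (hL : IsBody L) (hu : ‖u‖ = 1) {y : Hyp u} {s : ℝ}
    (h : pt u y s ∈ L) : -s ≤ topFun u (LpProjection.reflectBody u L) y :=
  (hL.reflectBody (u := u)).le_topFun hu (pt_mem_reflectBody.2 (by rwa [neg_neg]))

lemma IsBody.lineSection_eq_Icc (hL : IsBody L) (hu : ‖u‖ = 1) {y : Hyp u} (hy : y ∈ shadow u L) :
    lineSection L u y = Icc (-topFun u (LpProjection.reflectBody u L) y) (topFun u L y) := by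
  apply Subset.antisymm
  · exact fun s hs => ⟨neg_le.1 (hL.neg_le_topFun_reflect hu hs), hL.le_topFun hu hs⟩
  · exact (hL.convex_lineSection y).ordConnected.out (hL.neg_topFun_reflect_mem hu hy)
      (hL.pt_topFun_mem hu hy)

lemma lineSection_eq_empty {y : Hyp u} (hy : y ∉ shadow u L) :
    lineSection L u y = ∅ :=
  eq_empty_of_forall_notMem fun _ hs => hy (mem_shadow_of_pt hs)

/-- The lower boundary function of `L` is minus the upper one of `R_u L`. For `|t| ≤ 1` both weights
are nonnegative, so the highest point comes from the top of `L` and the bottom of `L`. -/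
lemma IsBody.topFun_reflectionShadow (hL : IsBody L) (hu : ‖u‖ = 1) {t : ℝ}
    (ht : t ∈ Icc (-1 : ℝ) 1) {y : Hyp u} (hy : y ∈ shadow u L) :
    topFun u (LpProjection.reflectionShadow L u t) y = (1 + t) / 2 * topFun u L y +
      (1 - t) / 2 * topFun u (LpProjection.reflectBody u L) y := by
  have h := (hL.reflectionShadow hu t).isGreatest_topFun hu
    (by rwa [shadow_reflectionShadow hu] : y ∈ shadow u (LpProjection.reflectionShadow L u t))
  refine h.unique ⟨?_, ?_⟩
  · exact (pt_mem_reflectionShadow hu).2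
      ⟨_, _, hL.pt_topFun_mem hu hy, hL.neg_topFun_reflect_mem hu hy, by ring⟩
  · intro s hs
    obtain ⟨a, b, ha, hb, rfl⟩ := (pt_mem_reflectionShadow hu).1 hs
    have h1 := mul_le_mul_of_nonneg_left (hL.le_topFun hu ha)
      (show 0 ≤ (1 + t) / 2 by linarith [ht.1])
    have h2 := mul_le_mul_of_nonneg_left (hL.neg_le_topFun_reflect hu hb)
      (show 0 ≤ (1 - t) / 2 by linarith [ht.2])
    linarith

lemma IsBody.topFun_reflectBody_reflectionShadow (hL : IsBody L) (hu : ‖u‖ = 1) {t : ℝ}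
    (ht : t ∈ Icc (-1 : ℝ) 1) {y : Hyp u} (hy : y ∈ shadow u L) :
    topFun u (LpProjection.reflectBody u (LpProjection.reflectionShadow L u t)) y =
      (1 + t) / 2 * topFun u (LpProjection.reflectBody u L) y + (1 - t) / 2 * topFun u L y := by
  rw [reflectBody_reflectionShadow' hu, (hL.reflectBody (u := u)).topFun_reflectionShadow hu ht
    (by rwa [shadow_reflectBody hu]), reflectBody_reflectBody]

lemma IsBody.volume_lineSection_reflectionShadow (hL : IsBody L) (hu : ‖u‖ = 1) {t : ℝ}
    (ht : t ∈ Icc (-1 : ℝ) 1) (y : Hyp u) :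
    volume (lineSection (LpProjection.reflectionShadow L u t) u y) =
      volume (lineSection L u y) := by
  by_cases hy : y ∈ shadow u L
  · have hy' : y ∈ shadow u (LpProjection.reflectionShadow L u t) := by
      rwa [shadow_reflectionShadow hu]
    rw [hL.lineSection_eq_Icc hu hy, (hL.reflectionShadow hu t).lineSection_eq_Icc hu hy',
      hL.topFun_reflectionShadow hu ht hy, hL.topFun_reflectBody_reflectionShadow hu ht hy,
      Real.volume_Icc, Real.volume_Icc]
    congr 1; ring
  · rw [lineSection_eq_empty hy, lineSection_eq_empty]
    rwa [shadow_reflectionShadow hu]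

lemma IsBody.volume_lineSection_reflectBody (hL : IsBody L) (hu : ‖u‖ = 1) (y : Hyp u) :
    volume (lineSection (LpProjection.reflectBody u L) u y) = volume (lineSection L u y) := by
  have h := hL.volume_lineSection_reflectionShadow hu (t := -1) (by norm_num) y
  rwa [← reflectBody_reflectionShadow hu, reflectionShadow_one hu] at h

lemma IsBody.reflectionShadow_zero (hL : IsBody L) (hu : ‖u‖ = 1) :
    LpProjection.reflectionShadow L u 0 = steinerSymm u L := by
  refine ext_pt hu fun y s => ?_
  have hvol : ∀ hy : y ∈ shadow u L, volume.real (lineSection L u y) =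
      topFun u L y + topFun u (LpProjection.reflectBody u L) y := by
    intro hy
    have h1 := hL.le_topFun hu (hL.neg_topFun_reflect_mem hu hy)
    rw [hL.lineSection_eq_Icc hu hy, Real.volume_real_Icc_of_le h1]; ring
  rw [pt_mem_reflectionShadow hu]
  constructor
  · rintro ⟨a, b, ha, hb, rfl⟩
    have hy := mem_shadow_of_pt ha
    refine ⟨y, y.2, ⟨a, ha⟩, _, ?_, rfl⟩
    rw [hvol hy, abs_le]
    have h1 := hL.le_topFun hu ha
    have h2 := hL.le_topFun hu hb
    have h3 := hL.neg_le_topFun_reflect hu ha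
    have h4 := hL.neg_le_topFun_reflect hu hb
    constructor <;> linarith
  · rintro ⟨y', hy', ⟨a, ha⟩, s', hs', hx⟩
    obtain ⟨rfl, rfl⟩ := pt_injective (z := ⟨y', hy'⟩) (t := s') hu hx
    have hy : (⟨y', hy'⟩ : Hyp u) ∈ shadow u L := mem_shadow_of_pt (s := a) ha
    rw [hvol hy, abs_le] at hs'
    set f := topFun u L ⟨y', hy'⟩
    set g := topFun u (LpProjection.reflectBody u L) ⟨y', hy'⟩
    have hIcc := hL.lineSection_eq_Icc hu hy
    -- The section is `[-g, f]`, with midpoint `(f - g)/2`; the two heights at distance `|s|` from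
    -- it have half-difference `s`.
    have h1 : f / 2 - g / 2 + s ∈ lineSection L u (⟨y', hy'⟩ : Hyp u) := by
      rw [hIcc]; constructor <;> linarith [hs'.1, hs'.2]
    have h2 : f / 2 - g / 2 - s ∈ lineSection L u (⟨y', hy'⟩ : Hyp u) := by
      rw [hIcc]; constructor <;> linarith [hs'.1, hs'.2]
    exact ⟨_, _, h1, h2, by ring⟩

end shadowSystem

/-! ### Convexity of the energy along the shadow system -/

/-- The function is the perspective `b (|a|/b)^p` of a convex power: apply Jensen to the quotients
`|a_i|/b_i` with weights `l b₁/B` and `m b₂/B`. -/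
lemma perspective_rpow_convex {p : ℝ} (hp : 1 ≤ p) {l m a₁ a₂ b₁ b₂ : ℝ} (hl : 0 ≤ l) (hm : 0 ≤ m)
    (hlm : l + m = 1) (hb₁ : 0 < b₁) (hb₂ : 0 < b₂) :
    |l * a₁ + m * a₂| ^ p * (l * b₁ + m * b₂) ^ (1 - p) ≤
      l * (|a₁| ^ p * b₁ ^ (1 - p)) + m * (|a₂| ^ p * b₂ ^ (1 - p)) := by
  set B := l * b₁ + m * b₂ with hB
  have hB0 : 0 < B := by
    rcases hl.eq_or_lt with h | h
    · have : m = 1 := by linarith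
      rw [hB, ← h, this]; linarith
    · have := mul_pos h hb₁
      have := mul_nonneg hm hb₂.le
      linarith
  have hpersp : ∀ {a b : ℝ}, 0 < b → |a| ^ p * b ^ (1 - p) = b * (|a| / b) ^ p := by
    intro a b hb
    rw [Real.div_rpow (abs_nonneg _) hb.le, Real.rpow_sub hb, Real.rpow_one]
    ring
  rw [hpersp hB0, hpersp hb₁, hpersp hb₂]
  have hx₁ : |a₁| / b₁ ∈ Ici (0 : ℝ) := div_nonneg (abs_nonneg _) hb₁.le
  have hx₂ : |a₂| / b₂ ∈ Ici (0 : ℝ) := div_nonneg (abs_nonneg _) hb₂.le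
  have hw₁ : 0 ≤ l * b₁ / B := by positivity
  have hw₂ : 0 ≤ m * b₂ / B := by positivity
  have hconv := (convexOn_rpow hp).2 hx₁ hx₂ hw₁ hw₂ (by rw [← add_div, ← hB, div_self hB0.ne'])
  simp only [smul_eq_mul] at hconv
  have hle : |l * a₁ + m * a₂| / B ≤ l * b₁ / B * (|a₁| / b₁) + m * b₂ / B * (|a₂| / b₂) := by
    have h1 : l * b₁ / B * (|a₁| / b₁) + m * b₂ / B * (|a₂| / b₂) = (l * |a₁| + m * |a₂|) / B := by
      field_simp
    rw [h1]
    gcongr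
    refine (abs_add_le _ _).trans ?_
    rw [abs_mul, abs_mul, abs_of_nonneg hl, abs_of_nonneg hm]
  have h2 := (Real.rpow_le_rpow (by positivity) hle (by linarith : 0 ≤ p)).trans hconv
  refine (mul_le_mul_of_nonneg_left h2 hB0.le).trans_eq ?_
  field_simp

/-- At almost every point both functions are differentiable, and the two arguments of the integrand
depend linearly on the function and the height; so the perspective inequality applies pointwise. -/
lemma graphEnergy_combination_le {f g h : Hyp u → ℝ} {U : Set (Hyp u)} (hU : IsOpen U)
    (hf : LocallyLipschitzOn U f) (hg : LocallyLipschitzOn U g)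
    (hfpos : ∀ y ∈ U, DifferentiableAt ℝ f y → 0 < f y - fderiv ℝ f y y)
    (hgpos : ∀ y ∈ U, DifferentiableAt ℝ g y → 0 < g y - fderiv ℝ g y y)
    {l m : ℝ} (hl : 0 ≤ l) (hm : 0 ≤ m) (hlm : l + m = 1)
    (hh : ∀ y ∈ U, h y = l * f y + m * g y) {p : ℝ} (hp : 1 ≤ p) (v : Hyp u) (s t : ℝ) :
    graphEnergy p h U v (l * s + m * t) ≤
      ENNReal.ofReal l * graphEnergy p f U v s + ENNReal.ofReal m * graphEnergy p g U v t := by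
  have hF := aemeasurable_graph_integrand hU hf p v s
  have hG := aemeasurable_graph_integrand hU hg p v t
  unfold graphEnergy
  rw [← lintegral_const_mul'' _ hF, ← lintegral_const_mul'' _ hG,
    ← lintegral_add_left' (hF.const_mul _)]
  have hdf : ∀ᵐ y ∂volume.restrict U, y ∈ U → DifferentiableAt ℝ f y :=
    ae_restrict_of_ae (measure_mono_null (fun y hy => by
      rw [mem_compl_iff, Set.mem_ofPred_eq, Classical.not_imp] at hy; exact hy)
      (ae_differentiableAt_of_locallyLipschitzOn hU hf))
  have hdg : ∀ᵐ y ∂volume.restrict U, y ∈ U → DifferentiableAt ℝ g y :=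
    ae_restrict_of_ae (measure_mono_null (fun y hy => by
      rw [mem_compl_iff, Set.mem_ofPred_eq, Classical.not_imp] at hy; exact hy)
      (ae_differentiableAt_of_locallyLipschitzOn hU hg))
  refine lintegral_mono_ae ?_
  filter_upwards [hdf, hdg, ae_restrict_mem hU.measurableSet] with y hy1 hy2 hy
  have hfy := hy1 hy
  have hgy := hy2 hy
  have hder : fderiv ℝ h y = l • fderiv ℝ f y + m • fderiv ℝ g y := by
    refine HasFDerivAt.fderiv (HasFDerivAt.congr_of_eventuallyEq
      ((hfy.hasFDerivAt.const_mul l).add (hgy.hasFDerivAt.const_mul m)) ?_)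
    filter_upwards [hU.mem_nhds hy] with z hz using hh z hz
  have hfp := hfpos y hy hfy
  have hgp := hgpos y hy hgy
  rw [← ENNReal.ofReal_mul hl, ← ENNReal.ofReal_mul hm,
    ← ENNReal.ofReal_add (by positivity) (by positivity)]
  refine ENNReal.ofReal_le_ofReal ?_
  rw [hder, hh y hy]
  simp only [add_apply, smul_apply, smul_eq_mul]
  have e1 : l * s + m * t - (l * fderiv ℝ f y v + m * fderiv ℝ g y v) =
      l * (s - fderiv ℝ f y v) + m * (t - fderiv ℝ g y v) := by ring
  have e2 : l * f y + m * g y - (l * fderiv ℝ f y y + m * fderiv ℝ g y y) =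
      l * (f y - fderiv ℝ f y y) + m * (g y - fderiv ℝ g y y) := by ring
  rw [e1, e2]
  exact perspective_rpow_convex hp hl hm hlm hfp hgp

section

variable {L : Set (Euc n)}

lemma IsBody.topFun_sub_fderiv_pos (hL : IsBody L) (hu : ‖u‖ = 1) {y : Hyp u}
    (hy : y ∈ interior (shadow u L)) (hd : DifferentiableAt ℝ (topFun u L) y) :
    0 < topFun u L y - fderiv ℝ (topFun u L) y y := by
  obtain ⟨hreg, hin⟩ := hL.normal_of_differentiableAt hu hy hd
  have hpos := hL.inner_pos_of_normal (gaussMap_spec hreg)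
  rw [hin] at hpos
  exact pos_of_mul_pos_right hpos (by positivity)

/-- Upper and lower parts are handled by convexity, the lower one with negated heights. All three
bodies have the same lateral term, which does not involve the heights, so `a` and `b` may be chosen
independently. -/
theorem IsBody.energy_reflectionShadow_le (hL : IsBody L) (hn : 0 < n) (hu : ‖u‖ = 1) {p : ℝ}
    (hp : 1 ≤ p) {t : ℝ} (ht : t ∈ Icc (-1 : ℝ) 1) (v : Hyp u) (a b : ℝ) :
    energy p (LpProjection.reflectionShadow L u t) (pt u v ((1 + t) / 2 * a + (1 - t) / 2 * b)) ≤
      ENNReal.ofReal ((1 + t) / 2) * energy p L (pt u v a) +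
      ENNReal.ofReal ((1 - t) / 2) * energy p (LpProjection.reflectBody u L) (pt u v b) := by
  have hl : 0 ≤ (1 + t) / 2 := by linarith [ht.1]
  have hm : 0 ≤ (1 - t) / 2 := by linarith [ht.2]
  have hlm : (1 + t) / 2 + (1 - t) / 2 = 1 := by ring
  have hR := hL.reflectBody (u := u)
  have hM := hL.reflectionShadow hu t
  have hshR : shadow u (LpProjection.reflectBody u L) = shadow u L := shadow_reflectBody hu
  have hlip := hL.locallyLipschitzOn_topFun hu
  have hlipR := hR.locallyLipschitzOn_topFun hu
  have hpos := fun y hy hd => hL.topFun_sub_fderiv_pos hu (y := y) hy hd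
  have hposR := fun y hy hd => hR.topFun_sub_fderiv_pos hu (y := y) hy hd
  rw [hshR] at hlipR hposR
  have h1 := graphEnergy_combination_le isOpen_interior hlip hlipR hpos hposR hl hm hlm
    (fun y hy => hL.topFun_reflectionShadow hu ht (interior_subset hy)) hp v a b
  have h2 := graphEnergy_combination_le isOpen_interior hlipR hlip hposR hpos hl hm hlm
    (fun y hy => hL.topFun_reflectBody_reflectionShadow hu ht (interior_subset hy)) hp v (-a) (-b)
  have h3 := hL.lintegral_lateral_congr hM hn hu (shadow_reflectionShadow hu t)
    (hL.volume_lineSection_reflectionShadow hu ht) p (v := pt u v a)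
    (v' := pt u v ((1 + t) / 2 * a + (1 - t) / 2 * b)) (by rw [hproj_pt, hproj_pt])
  have h4 := hL.lintegral_lateral_congr hR hn hu hshR
    (hL.volume_lineSection_reflectBody hu) p (v := pt u v a)
    (v' := pt u v b) (by rw [hproj_pt, hproj_pt])
  rw [hM.energy_eq hu, hL.energy_eq hu, hR.energy_eq hu, reflectBody_reflectBody, h3, h4, hshR,
    shadow_reflectionShadow hu]
  simp only [hproj_pt, inner_pt_u hu]
  rw [show -((1 + t) / 2 * a + (1 - t) / 2 * b) = (1 + t) / 2 * -a + (1 - t) / 2 * -b by ring]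
  set X := ∫⁻ x in lateralBoundary u L, energyDensity p L (pt u v a) x ∂μHE[n - 1]
  have hX : X = ENNReal.ofReal ((1 + t) / 2) * X + ENNReal.ofReal ((1 - t) / 2) * X := by
    rw [← add_mul, ← ENNReal.ofReal_add hl hm, hlm, ENNReal.ofReal_one, one_mul]
  refine (add_le_add (add_le_add h1 h2) hX.le).trans_eq ?_
  ring

end

/-! ### Comparison of volumes -/

/-- For `x ≤ y` in `S` and `0 ≤ d ≤ y - x`, take `a = x + d` and `b = y - d`: then `l a - m b = (l x
- m y) + d`. So `T` contains an interval of length `y - x`, and the length of `S` is at most its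
diameter. -/
lemma volume_le_of_combination {S T : Set ℝ} (hS : Convex ℝ S) {l m : ℝ} (hlm : l + m = 1)
    (h : ∀ a ∈ S, ∀ b ∈ S, l * a - m * b ∈ T) : volume S ≤ volume T := by
  refine (Real.volume_le_diam S).trans (Metric.ediam_le fun x hx y hy => ?_)
  wlog hxy : x ≤ y generalizing x y
  · rw [edist_comm]; exact this y hy x hx (le_of_not_ge hxy)
  have hsub : Icc (l * x - m * y) (l * x - m * y + (y - x)) ⊆ T := by
    intro z hz
    have hd0 : 0 ≤ z - (l * x - m * y) := by linarith [hz.1]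
    have hd1 : z - (l * x - m * y) ≤ y - x := by linarith [hz.2]
    have ha : x + (z - (l * x - m * y)) ∈ S :=
      hS.ordConnected.out hx hy ⟨by linarith, by linarith⟩
    have hb : y - (z - (l * x - m * y)) ∈ S :=
      hS.ordConnected.out hx hy ⟨by linarith, by linarith⟩
    have := h _ ha _ hb
    convert this using 1
    linear_combination (l * x - m * y - z) * hlm
  refine le_trans ?_ (measure_mono hsub)
  rw [Real.volume_Icc, edist_comm, edist_dist, Real.dist_eq, abs_of_nonneg (by linarith)]
  exact ENNReal.ofReal_le_ofReal (by linarith)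

lemma volume_eq_lintegral_sections (hu : ‖u‖ = 1) {C : Set (Euc n)} (hC : MeasurableSet C) :
    volume C = ∫⁻ y : Hyp u, volume (lineSection C u y) := by
  rw [← (measurePreserving_pt hu).measure_preimage hC.nullMeasurableSet,
    Measure.prod_apply ((measurePreserving_pt hu).measurable hC)]
  rfl

section

variable {L : Set (Euc n)} {p : ℝ}

theorem IsBody.volume_polarProjectionBody_reflectBody (hL : IsBody L) (hn : 2 ≤ n) (hp : 1 < p) :
    volume (polarProjectionBody p (LpProjection.reflectBody u L)) =
      volume (polarProjectionBody p L) := by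
  have h : polarProjectionBody p (LpProjection.reflectBody u L) =
      refl u ⁻¹' polarProjectionBody p L := by
    rw [hL.polarProjectionBody_eq hn hp, (hL.reflectBody (u := u)).polarProjectionBody_eq hn hp]
    ext v
    simp only [mem_preimage, Set.mem_ofPred_eq, hL.energy_reflectBody]
  rw [h, (refl u).measurePreserving.measure_preimage
    measurableSet_polarProjectionBody.nullMeasurableSet]

theorem IsBody.volume_polarProjectionBody_le (hL : IsBody L) (hn : 2 ≤ n) (hp : 1 < p)
    (hu : ‖u‖ = 1) {t : ℝ} (ht : t ∈ Icc (-1 : ℝ) 1) :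
    volume (polarProjectionBody p L) ≤
      volume (polarProjectionBody p (LpProjection.reflectionShadow L u t)) := by
  rw [volume_eq_lintegral_sections hu measurableSet_polarProjectionBody,
    volume_eq_lintegral_sections hu measurableSet_polarProjectionBody]
  refine lintegral_mono fun y => ?_
  have hl : 0 ≤ (1 + t) / 2 := by linarith [ht.1]
  have hm : 0 ≤ (1 - t) / 2 := by linarith [ht.2]
  have hlm : (1 + t) / 2 + (1 - t) / 2 = 1 := by ring
  refine volume_le_of_combination ?_ hlm ?_
  · intro a ha b hb c d hc hd hcd
    rw [mem_lineSection] at *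
    have := convex_polarProjectionBody ha hb hc hd hcd
    rwa [pt_smul, pt_smul, pt_add, ← add_smul, hcd, one_smul] at this
  · intro a ha b hb
    rw [mem_lineSection] at *
    rw [hL.polarProjectionBody_eq hn hp, Set.mem_ofPred_eq] at ha hb
    rw [(hL.reflectionShadow hu t).polarProjectionBody_eq hn hp, Set.mem_ofPred_eq]
    -- The height `-b` is chosen because the energy of `R_u L` at `(y, -b)` is that of `L` at `(y,
    -- b)`.
    have h := hL.energy_reflectionShadow_le (by omega) hu hp.le ht y a (-b)
    rw [hL.energy_reflectBody, refl_pt, neg_neg, mul_neg, ← sub_eq_add_neg] at h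
    refine h.trans ((add_le_add (mul_le_mul_right ha _) (mul_le_mul_right hb _)).trans_eq ?_)
    rw [← add_mul, ← ENNReal.ofReal_add hl hm, hlm, ENNReal.ofReal_one, one_mul]

end

end LpProjection

end

/-! ### Symmetry, monotonicity and the Steiner inequality -/

theorem mainTheorem4 (n : ℕ) (hn : 2 ≤ n) (p : ℝ) (hp : 1 < p)
    (K : ConvexBody (LpProjection.Euc n)) (hK : (0 : LpProjection.Euc n) ∈ interior (K : Set (LpProjection.Euc n)))
    (u : LpProjection.Euc n) (hu : ‖u‖ = 1) :
    (∀ t ∈ Set.Icc (-1 : ℝ) 1,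
      volume (LpProjection.polarProjectionBody p (LpProjection.reflectionShadow (K : Set (LpProjection.Euc n)) u t)) =
        volume (LpProjection.polarProjectionBody p (LpProjection.reflectionShadow (K : Set (LpProjection.Euc n)) u (-t)))) ∧
    AntitoneOn
      (fun t : ℝ => volume
        (LpProjection.polarProjectionBody p (LpProjection.reflectionShadow (K : Set (LpProjection.Euc n)) u t)))
      (Set.Icc (0 : ℝ) 1) ∧
    volume (LpProjection.polarProjectionBody p (K : Set (LpProjection.Euc n))) ≤
      volume (LpProjection.polarProjectionBody p (LpProjection.steinerSymm u (K : Set (LpProjection.Euc n)))) := by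
  have hB : LpProjection.IsBody (K : Set (LpProjection.Euc n)) := ⟨K.convex, K.isCompact, hK⟩
  refine ⟨fun t _ => ?_, ?_, ?_⟩
  · rw [← LpProjection.reflectBody_reflectionShadow hu,
      (hB.reflectionShadow hu t).volume_polarProjectionBody_reflectBody hn hp]
  · intro t ht t' ht' htt'
    -- If `t' = 0` then `t = 0`; otherwise `K_t` is the member with parameter `t / t'` of the shadow
    -- system of `K_{t'}`.
    rcases ht'.1.eq_or_lt with h0 | h0
    · have : t = t' := le_antisymm htt' (h0 ▸ ht.1)
      rw [this]
    · have hτ : t / t' ∈ Set.Icc (-1 : ℝ) 1 :=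
        ⟨by have := div_nonneg ht.1 h0.le; linarith, (div_le_one h0).2 htt'⟩
      have ht1 : t' ∈ Set.Icc (-1 : ℝ) 1 := ⟨by linarith, ht'.2⟩
      have h := (hB.reflectionShadow hu t').volume_polarProjectionBody_le hn hp hu hτ
      rwa [hB.reflectionShadow_reflectionShadow hu ht1 hτ, mul_div_cancel₀ _ h0.ne'] at h
  · rw [← hB.reflectionShadow_zero hu]
    exact hB.volume_polarProjectionBody_le hn hp hu (by norm_num)
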